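/- **Parameters.** Let $q\in\mathbb C$ with $0<|q|<1$, fix a logarithm $\ln q$ and put $q^x=e^{x\ln q}$ for $x\in\mathbb C$. Let $r,k\in\mathbb R$ with $r>0$, $r^*:=r-k>0$, $k\ne 0,-2$, and let $l\in\mathbb Z_{\ge 0}$. Put $[x]=\frac{q^x-q^{-x}}{q-q^{-1}}$, $(z;t)_\infty=\prod_{n\ge0}(1-zt^n)$, $\Theta_t(z)=(z;t)_\infty(tz^{-1};t)_\infty(t;t)_\infty$, $$\theta_\nu(u)=q^{\frac{u^2}{\nu}-u}\frac{\Theta_{q^{2\nu}}(q^{2u})}{(q^{2\nu};q^{2\nu})_\infty^3},\qquad \theta=\theta_r,\quad \theta^*=\theta_{r^*},$$ and write $z=q^{2u}$, $w=q^{2v}$, $\ln z=2u\ln q$, $\ln w=2v\ln q$. **Bosons.** Let $a_n,b_n,c_n$ ($n\ne0$) and zero modes $q_a,p_a,q_b,p_b,q_c,p_c,\hat q,\hat p$ satisfy $$[a_n,a_m]=\tfrac{[(k+2)n][2n]}{n}\delta_{n+m,0},\quad [b_n,b_m]=-\tfrac{[n]^2}{n}\delta_{n+m,0},\quad [c_n,c_m]=\tfrac{[n]^2}{n}\delta_{n+m,0},$$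 $$[p_a,q_a]=2(k+2),\quad [p_b,q_b]=-1,\quad [p_c,q_c]=1,\quad [\hat q,\hat p]=1,$$ all other commutators being zero. They act on the Fock space with basis the vectors $\prod x_{-n}^{e_{x,n}}\,e^{\mu_aq_a+\mu_bq_b+\mu_cq_c+\hat\mu\hat q}|0\rangle$ (with $x\in\{a,b,c\}$, $n>0$, finitely many $e_{x,n}\in\mathbb Z_{\ge0}$ nonzero, $\mu_a,\mu_b,\mu_c,\hat\mu\in\mathbb C$), where $|0\rangle$ is killed by all $x_n$, $n>0$, and by $p_a,p_b,p_c,\hat p$. Normal ordering $:\ :$ puts $x_{-n}$ ($n>0$) and the modes $q_\bullet,\hat q$ to the left of $x_n$ ($n>0$) and $p_\bullet,\hat p$. For $x=a,b,c$ put $$x(z)=-\sum_{n\neq0}\frac{x_n}{[n]}z^{-n}+q_x+p_x\ln z,\qquad x_\pm(z)=\pm\Big((q-q^{-1})\sum_{n>0}x_{\pm n}z^{\mp n}+p_x\ln q\Big),$$ $$x^*_+(z)=-\sum_{n>0}\frac{x_n}{[rn]}z^{-n},\qquad x^*_-(z)=\sum_{n>0}\frac{x_{-n}}{[r^*n]}z^n,$$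 $$X_\pm(L_1,\dots,L_s;M_1,\dots,M_t|z;\alpha)=\sum_{n>0}\frac{[L_1n]\cdots[L_sn]}{[M_1n]\cdots[M_tn]}\,x_{\pm n}(q^\alpha z)^{\mp n}\qquad (X=A,B,C),$$ with $\alpha=0$ when it is omitted, and $(b+c)(z)=b(z)+c(z)$. **Currents.** Let $$U^+(z)=\exp\big[a^*_-(q^{r^*+\frac k2-1}z)+b^*_-(q^{r^*}z)+b^*_-(q^{r^*-2}z)\big],$$ $$U^-(z)=\exp\big[a^*_+(q^{-(r-\frac k2-1)}z)+b^*_+(q^{-(r-k-2)}z)+b^*_+(q^{-(r-k)}z)\big],$$ $$\psi_\pm(z)=\,:\exp\big[b_\pm(q^{\pm\frac k2}z)+a_\pm(q^{\pm1}z)+b_\pm(q^{\pm(\frac k2+2)}z)\big]:,$$ $$e^+(z)=\tfrac{-1}{(q-q^{-1})z}:\big\{e^{b_+(z)-(b+c)(qz)}-e^{b_-(z)-(b+c)(q^{-1}z)}\big\}:,$$ $$e^-(z)=\tfrac{-1}{(q-q^{-1})z}:\big\{e^{(b+c)(q^{-(k+1)}z)+a_-(q^{-\frac{k+2}2}z)+b_-(q^{-(k+2)}z)}-e^{(b+c)(q^{k+1}z)+a_+(q^{\frac{k+2}2}z)+b_+(q^{k+2}z)}\big\}:,$$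 and define $$H^\pm(u)=U^+(q^{\pm\frac k2}z)\,\psi_\pm(z)\,U^-(q^{\mp\frac k2}z)\,e^{2\hat q}\,(q^{\mp\frac k2}z)^{\frac{2p_b+p_a}r}\,(q^{\pm(r-\frac k2)}z)^{\frac{\hat p-1}r-\frac{\hat p-1}{r^*}},$$ $$E(u)=U^+(z)e^+(z)e^{2\hat q}z^{-\frac{\hat p-1}{r^*}},\qquad F(u)=e^-(z)U^-(z)z^{\frac{2p_b+p_a}r}z^{\frac{\hat p-1}r}.$$ **Vertex operators.** Let $$V^+(w)=\exp\{-A_+(l,r^*;2,k,r|w;\tfrac{k+2}2)-B_+(l,r^*;1,k,r|w;k+1)\},$$ $$V^-(w)=\exp\{A_-(-l,r;2,k,r^*|w;\tfrac{k-2}2)+B_-(-l,r;1,k,r^*|w;-1)\},$$ and let the highest components of the type I and type II vertex operators be the normal ordered expressions $$\Phi_{l,l}(v)=\,:V^+(w)\exp\{A_-(l;2,k+2|w;\tfrac{k+2}2)+A_+(l;k,k+2|w;\tfrac{k+2}2)+B_+(l;1,k|w;1)\}\exp\{\tfrac{l\,q_a}{2(k+2)}-\tfrac l{2r}(2p_b+\hat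 p)\ln w\}:,$$ $$\begin{aligned}\Psi^*_{l,l}(v)=\,:V^-(w)\exp\{&-A_-(-l,k+1;1,k,k+2|w;-\tfrac{k+2}2)+A_+(-l;2,k+2|w;\tfrac{k+2}2)\\&-B_-(-l,k+1;1,1,k|w;-1)+B_+(-l;1,1|w)-C_-(-l;1,1|w)+C_+(-l;1,1|w)\}\\&\times\exp\{\tfrac{l\,q_a}{2(k+2)}+l(q_b+q_c)-l\hat q+\tfrac l{2r^*}\hat p\ln w\}:.\end{aligned}$$ **Theorem.** For each of the products $X(u)Y(v)$ below, all matrix elements of $X(u)Y(v)$ converge absolutely for $|w/z|$ small and all matrix elements of $Y(v)X(u)$ converge absolutely for $|z/w|$ small; they extend to meromorphic functions of $(u,v)\in\mathbb C^2$, and in the sense of these analytic continuations $$H^\pm(u)\Phi_{l,l}(v)=\frac{\theta(u-v+\frac l2\mp\frac k4)}{\theta(u-v-\frac l2\mp\frac k4)}\Phi_{l,l}(v)H^\pm(u),$$ $$E(u)\Phi_{l,l}(v)=\Phi_{l,l}(v)E(u),\qquad F(u)\Phi_{l,l}(v)=\frac{\theta(u-v+\frac l2)}{\theta(u-v-\frac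 l2)}\Phi_{l,l}(v)F(u),$$ $$H^\pm(u)\Psi^*_{l,l}(v)=\frac{\theta^*(u-v-\frac l2\pm\frac k4)}{\theta^*(u-v+\frac l2\pm\frac k4)}\Psi^*_{l,l}(v)H^\pm(u),$$ $$F(u)\Psi^*_{l,l}(v)=\Psi^*_{l,l}(v)F(u),\qquad E(u)\Psi^*_{l,l}(v)=\frac{\theta^*(u-v-\frac l2)}{\theta^*(u-v+\frac l2)}\Psi^*_{l,l}(v)E(u).$$ -/

import Mathlib

namespace EllipticSl2

noncomputable section

/-- The parameters: a logarithm `logq` of the deformation parameter `q`, the level `k`, and `r`. -/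
structure Params where
  logq : ℂ
  k : ℝ
  r : ℝ

/-- `r* = r - c`, where the central element `c` acts as the level `k`. -/
def Params.rs (P : Params) : ℝ := P.r - P.k

/-- `q ^ x`, with respect to the chosen logarithm of `q`. -/
def qpow (P : Params) (x : ℂ) : ℂ := Complex.exp (x * P.logq)

/-- `[x] = (q^x - q^{-x}) / (q - q⁻¹)`. -/
def qnum (P : Params) (x : ℂ) : ℂ :=
  (qpow P x - qpow P (-x)) / (qpow P 1 - qpow P (-1))

/-! ### Theta functions -/

/-- `(z; t)_∞ = ∏_{n ≥ 0} (1 - z t^n)`. -/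
def qPoch (z t : ℂ) : ℂ := ∏' n : ℕ, (1 - z * t ^ n)

/-- `Θ_t(z) = (z; t)_∞ (t z⁻¹; t)_∞ (t; t)_∞`. -/
def Theta (t z : ℂ) : ℂ := qPoch z t * qPoch (t * z⁻¹) t * qPoch t t

/-- The Jacobi theta function
`θ_ν(u) = q^{u²/ν - u} Θ_{q^{2ν}}(q^{2u}) / (q^{2ν}; q^{2ν})_∞³`. -/
def theta (P : Params) (ν : ℝ) (u : ℂ) : ℂ :=
  qpow P (u ^ 2 / ν - u) * Theta (qpow P (2 * ν)) (qpow P (2 * u)) /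
    qPoch (qpow P (2 * ν)) (qpow P (2 * ν)) ^ 3

/-! ### The Heisenberg algebra and linear combinations of its generators -/

/-- The three oscillating bosons. -/
inductive Boson where
  | a | b | c
  deriving DecidableEq

/-- The four canonical pairs of zero modes: `(q_a, p_a)`, `(q_b, p_b)`, `(q_c, p_c)` and
`(q̂, p̂)`. -/
inductive ZeroMode where
  | a | b | c | hat
  deriving DecidableEq

/-- The zero modes of an oscillating boson. -/
def Boson.zero : Boson → ZeroMode
  | .a => .a
  | .b => .b
  | .c => .c

/-- The pair `(x, n)` labels the creation operator `x_{-n}` and the annihilation operator `x_n`. -/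
abbrev Mode : Type := Boson × ℕ+

/-- The scalar `[x_n, x_{-n}]`, for `n > 0`. -/
def oscComm (P : Params) : Mode → ℂ
  | (.a, n) => qnum P ((P.k + 2) * (n : ℕ)) * qnum P (2 * (n : ℕ)) / (n : ℕ)
  | (.b, n) => -(qnum P (n : ℕ) ^ 2 / (n : ℕ))
  | (.c, n) => qnum P (n : ℕ) ^ 2 / (n : ℕ)

/-- The scalar `[p_x, q_x]`; for the last pair `[q̂, p̂] = 1`. -/
def zeroComm (P : Params) : ZeroMode → ℂ
  | .a => 2 * (P.k + 2)
  | .b => -1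
  | .c => 1
  | .hat => -1

/-- The generators of the Heisenberg algebra: `ann (x, n)` is `x_n`, `cre (x, n)` is `x_{-n}`
(`n > 0`), `q` and `p` are the zero modes, `one` is the unit. -/
inductive Gen where
  | ann (i : Mode)
  | cre (i : Mode)
  | q (x : ZeroMode)
  | p (x : ZeroMode)
  | one

/-- A possibly infinite linear combination of the generators, given by its coefficients. -/
abbrev Boselin : Type := Gen → ℂ

/-- `∑_{n > 0} f(n) x_n`. -/
def annSum (x : Boson) (f : ℕ → ℂ) : Boselin
  | .ann (y, n) => if y = x then f n else 0
  | _ => 0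

/-- `∑_{n > 0} f(n) x_{-n}`. -/
def creSum (x : Boson) (f : ℕ → ℂ) : Boselin
  | .cre (y, n) => if y = x then f n else 0
  | _ => 0

/-- The zero mode `q_x`. -/
def qZ (x : ZeroMode) : Boselin
  | .q y => if y = x then 1 else 0
  | _ => 0

/-- The zero mode `p_x`. -/
def pZ (x : ZeroMode) : Boselin
  | .p y => if y = x then 1 else 0
  | _ => 0

/-- The unit. -/
def oneZ : Boselin
  | .one => 1
  | _ => 0

/-! ### Fock space and normal ordered exponentials -/

/-- Oscillator monomials `∏ x_{-n}^{e (x, n)}`. -/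
abbrev Occ : Type := Mode →₀ ℕ

/-- The basis of the total Fock space: `(μ, e)` stands for the vector
`∏ x_{-n}^{e (x, n)} exp(μ_a q_a + μ_b q_b + μ_c q_c + μ_hat q̂) |0⟩`, on which `p_x` acts as
`[p_x, q_x] μ_x`. In particular `|l, m₁, m₂⟩ ⊗ |n⟩` has `μ = (l / (2 (k + 2)), m₁, m₂, n)`. -/
abbrev Idx : Type := (ZeroMode → ℂ) × Occ

/-- A linear map from the Fock space to its completion (the infinite linear combinations of basis
vectors), given by its matrix: `A i j` is the coefficient of the `i`-th basis vector in the image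
of the `j`-th one. -/
abbrev Op : Type := Idx → Idx → ℂ

/-- `exp(∑ f(x, n) x_{-n})` as a power series in the commuting creation operators. -/
def creExp (f : Mode → ℂ) : MvPowerSeries Mode ℂ :=
  fun e => e.prod fun i t => f i ^ t / (t.factorial : ℂ)

/-- `∑ f(x, n) x_n` as an operator on the polynomials in the creation operators: the derivation
with `x_{-n} ↦ f(x, n) [x_n, x_{-n}]`, which kills the vacuum. -/
def annOp (P : Params) (f : Mode → ℂ) :
    Derivation ℂ (MvPolynomial Mode ℂ) (MvPolynomial Mode ℂ) :=
  MvPolynomial.mkDerivation ℂ fun i => MvPolynomial.C (f i * oscComm P i)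

/-- `exp(∑ f(x, n) x_n)` on the polynomials in the creation operators. The operator in the
exponent lowers the degree, hence the exponential series stops. -/
def annExp (P : Params) (f : Mode → ℂ) (m : MvPolynomial Mode ℂ) : MvPolynomial Mode ℂ :=
  ∑ N ∈ Finset.range (m.totalDegree + 1),
    (N.factorial : ℂ)⁻¹ • ((annOp P f : MvPolynomial Mode ℂ →ₗ[ℂ] MvPolynomial Mode ℂ) ^ N) m

open scoped Classical in
/-- The normal ordered exponential `:exp X:`, that is,
`exp(X_cre) exp(X_q) exp(X_p) exp(X_ann) exp(X_one)`. -/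
def nexp (P : Params) (X : Boselin) : Op := fun i j =>
  if i.1 = (fun x => j.1 x + X (.q x)) then
    Complex.exp (X .one
        + X (.p .a) * (zeroComm P .a * j.1 .a) + X (.p .b) * (zeroComm P .b * j.1 .b)
        + X (.p .c) * (zeroComm P .c * j.1 .c) + X (.p .hat) * (zeroComm P .hat * j.1 .hat)) *
      MvPowerSeries.coeff i.2 (creExp (fun m => X (.cre m)) *
        ((annExp P (fun m => X (.ann m)) (MvPolynomial.monomial j.2 1) :
          MvPolynomial Mode ℂ) : MvPowerSeries Mode ℂ))
  else 0

/-! ### Boson fields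

A point `z ≠ 0` is given by `s : ℂ` with `z = q^s`, so that `q^α z` is given by `s + α`, and
`ln z = s ln q`. -/

/-- `x(z) = -∑_{n ≠ 0} (x_n / [n]) z^{-n} + q_x + p_x ln z`. -/
def boson (P : Params) (x : Boson) (s : ℂ) : Boselin :=
  -(annSum x fun n => qpow P (-(s * n)) / qnum P n)
    - (creSum x fun n => qpow P (s * n) / qnum P (-n))
    + qZ x.zero + (s * P.logq) • pZ x.zero

/-- `(b + c)(z)`. -/
def bcField (P : Params) (s : ℂ) : Boselin := boson P .b s + boson P .c s

/-- `x_+(z) = (q - q⁻¹) ∑_{n > 0} x_n z^{-n} + p_x ln q`. -/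
def fPlus (P : Params) (x : Boson) (s : ℂ) : Boselin :=
  (qpow P 1 - qpow P (-1)) • (annSum x fun n => qpow P (-(s * n))) + P.logq • pZ x.zero

/-- `x_-(z) = -((q - q⁻¹) ∑_{n > 0} x_{-n} z^n + p_x ln q)`. -/
def fMinus (P : Params) (x : Boson) (s : ℂ) : Boselin :=
  -((qpow P 1 - qpow P (-1)) • (creSum x fun n => qpow P (s * n)) + P.logq • pZ x.zero)

/-- `x*_+(z) = -∑_{n > 0} (x_n / [r n]) z^{-n}`. -/
def sPlus (P : Params) (x : Boson) (s : ℂ) : Boselin :=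
  -(annSum x fun n => qpow P (-(s * n)) / qnum P (P.r * n))

/-- `x*_-(z) = ∑_{n > 0} (x_{-n} / [r* n]) z^n`. -/
def sMinus (P : Params) (x : Boson) (s : ℂ) : Boselin :=
  creSum x fun n => qpow P (s * n) / qnum P (P.rs * n)

/-- `[L₁ n] ⋯ [L_s n] / ([M₁ n] ⋯ [M_t n])`. -/
def qRatio (P : Params) (L M : List ℝ) (n : ℕ) : ℂ :=
  (L.map fun x => qnum P (x * n)).prod / (M.map fun x => qnum P (x * n)).prod

/-- `X_+(L; M | z; α) = ∑_{n > 0} ([L n] / [M n]) x_n (q^α z)^{-n}`. -/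
def lmPlus (P : Params) (x : Boson) (L M : List ℝ) (s : ℂ) (α : ℝ) : Boselin :=
  annSum x fun n => qRatio P L M n * qpow P (-((s + α) * n))

/-- `X_-(L; M | z; α) = ∑_{n > 0} ([L n] / [M n]) x_{-n} (q^α z)^n`. -/
def lmMinus (P : Params) (x : Boson) (L M : List ℝ) (s : ℂ) (α : ℝ) : Boselin :=
  creSum x fun n => qRatio P L M n * qpow P ((s + α) * n)

/-! ### The currents `H^±`, `E`, `F`

All products below are already in normal order, so a product of exponentials is the normal ordered
exponential of the sum of the exponents. -/

/-- The exponent of `U⁺(z; r, r*)`: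
`a*_-(q^{r* + k/2 - 1} z) + b*_-(q^{r* - 1} (q + q⁻¹) z)`, where
`b*_-(x (q + q⁻¹) z) = b*_-(x q z) + b*_-(x q⁻¹ z)`. -/
def logUPlus (P : Params) (s : ℂ) : Boselin :=
  sMinus P .a (s + P.rs + P.k / 2 - 1)
    + (sMinus P .b (s + (P.rs - 1) + 1) + sMinus P .b (s + (P.rs - 1) - 1))

/-- The exponent of `U⁻(z; r, r*)`:
`a*_+(q^{-(r - k/2 - 1)} z) + b*_+(q^{-(r - k - 1)} (q + q⁻¹) z)`, with the same convention. -/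
def logUMinus (P : Params) (s : ℂ) : Boselin :=
  sPlus P .a (s - (P.r - P.k / 2 - 1))
    + (sPlus P .b (s - (P.r - P.k - 1) + 1) + sPlus P .b (s - (P.r - P.k - 1) - 1))

/-- The exponent of `ψ_+(z)`. -/
def logPsiPlus (P : Params) (s : ℂ) : Boselin :=
  fPlus P .b (s + P.k / 2) + fPlus P .a (s + 1) + fPlus P .b (s + (P.k / 2 + 2))

/-- The exponent of `ψ_-(z)`. -/
def logPsiMinus (P : Params) (s : ℂ) : Boselin :=
  fMinus P .b (s - P.k / 2) + fMinus P .a (s - 1) + fMinus P .b (s - (P.k / 2 + 2))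

/-- `p̂ - 1`. -/
def pHatSubOne : Boselin := pZ .hat - oneZ

/-- `2 p_b + p_a`. -/
def twoPbPa : Boselin := (2 : ℂ) • pZ .b + pZ .a

/-- `H⁺(u) = U⁺(q^{k/2} z) ψ_+(z) U⁻(q^{-k/2} z) e^{2 q̂} (q^{-k/2} z)^{(2 p_b + p_a)/r}
(q^{r - k/2} z)^{(p̂ - 1)/r - (p̂ - 1)/r*}`, with `z = q^{2u}`. -/
def HPlus (P : Params) (u : ℂ) : Op :=
  nexp P (logUPlus P (2 * u + P.k / 2) + logPsiPlus P (2 * u) + logUMinus P (2 * u - P.k / 2)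
    + (2 : ℂ) • qZ .hat
    + ((2 * u - P.k / 2) * P.logq / P.r) • twoPbPa
    + ((2 * u + (P.r - P.k / 2)) * P.logq * (1 / P.r - 1 / P.rs)) • pHatSubOne)

/-- `H⁻(u) = U⁺(q^{-k/2} z) ψ_-(z) U⁻(q^{k/2} z) e^{2 q̂} (q^{k/2} z)^{(2 p_b + p_a)/r}
(q^{-(r - k/2)} z)^{(p̂ - 1)/r - (p̂ - 1)/r*}`, with `z = q^{2u}`. -/
def HMinus (P : Params) (u : ℂ) : Op :=
  nexp P (logUPlus P (2 * u - P.k / 2) + logPsiMinus P (2 * u) + logUMinus P (2 * u + P.k / 2)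
    + (2 : ℂ) • qZ .hat
    + ((2 * u + P.k / 2) * P.logq / P.r) • twoPbPa
    + ((2 * u - (P.r - P.k / 2)) * P.logq * (1 / P.r - 1 / P.rs)) • pHatSubOne)

/-- `E(u) = U⁺(z) e⁺(z) e^{2 q̂} z^{-(p̂ - 1)/r*}`, with `z = q^{2u}` and
`e⁺(z) = -1/((q - q⁻¹) z) :{exp[b_+(z) - (b+c)(q z)] - exp[b_-(z) - (b+c)(q⁻¹ z)]}:`. -/
def E (P : Params) (u : ℂ) : Op :=
  let rest : Boselin := logUPlus P (2 * u) + (2 : ℂ) • qZ .hat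
    - (2 * u * P.logq / P.rs) • pHatSubOne
  (-1 / ((qpow P 1 - qpow P (-1)) * qpow P (2 * u))) •
    (nexp P (fPlus P .b (2 * u) - bcField P (2 * u + 1) + rest)
      - nexp P (fMinus P .b (2 * u) - bcField P (2 * u - 1) + rest))

/-- `F(u) = e⁻(z) U⁻(z) z^{(2 p_b + p_a)/r} z^{(p̂ - 1)/r}`, with `z = q^{2u}` and
`e⁻(z) = -1/((q - q⁻¹) z)
:{exp[(b+c)(q^{-(k+1)} z)] exp[a_-(q^{-(k+2)/2} z) + b_-(q^{-(k+2)} z)]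
- exp[(b+c)(q^{k+1} z)] exp[a_+(q^{(k+2)/2} z) + b_+(q^{k+2} z)]}:`. -/
def F (P : Params) (u : ℂ) : Op :=
  let rest : Boselin := logUMinus P (2 * u) + (2 * u * P.logq / P.r) • twoPbPa
    + (2 * u * P.logq / P.r) • pHatSubOne
  (-1 / ((qpow P 1 - qpow P (-1)) * qpow P (2 * u))) •
    (nexp P (bcField P (2 * u - (P.k + 1)) + fMinus P .a (2 * u - (P.k + 2) / 2)
          + fMinus P .b (2 * u - (P.k + 2)) + rest)
      - nexp P (bcField P (2 * u + (P.k + 1)) + fPlus P .a (2 * u + (P.k + 2) / 2)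
          + fPlus P .b (2 * u + (P.k + 2)) + rest))

/-! ### The highest components of the vertex operators -/

/-- The exponent of
`V⁺(w; r, r*) = exp{-A_+(l, r*; 2, k, r | w; (k+2)/2) - B_+(l, r*; 1, k, r | w; k+1)}`. -/
def logVPlus (P : Params) (l : ℕ) (s : ℂ) : Boselin :=
  -lmPlus P .a [(l : ℝ), P.rs] [2, P.k, P.r] s ((P.k + 2) / 2)
    - lmPlus P .b [(l : ℝ), P.rs] [1, P.k, P.r] s (P.k + 1)

/-- The exponent of
`V⁻(w; r, r*) = exp{A_-(-l, r; 2, k, r* | w; (k-2)/2) + B_-(-l, r; 1, k, r* | w; -1)}`. -/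
def logVMinus (P : Params) (l : ℕ) (s : ℂ) : Boselin :=
  lmMinus P .a [-(l : ℝ), P.r] [2, P.k, P.rs] s ((P.k - 2) / 2)
    + lmMinus P .b [-(l : ℝ), P.r] [1, P.k, P.rs] s (-1)

/-- The highest component `Φ_{l,l}(v)` of the type I vertex operator, with `w = q^{2v}`:
`V⁺(w; r, r*) exp{A_-(l; 2, k+2 | w; (k+2)/2) + A_+(l; k, k+2 | w; (k+2)/2) + B_+(l; 1, k | w; 1)}
exp{l q_a / (2(k+2)) - (l / 2r) (2 p_b + p̂) ln w}`, normal ordered. -/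
def Phi (P : Params) (l : ℕ) (v : ℂ) : Op :=
  nexp P (logVPlus P l (2 * v)
    + (lmMinus P .a [(l : ℝ)] [2, P.k + 2] (2 * v) ((P.k + 2) / 2)
      + lmPlus P .a [(l : ℝ)] [P.k, P.k + 2] (2 * v) ((P.k + 2) / 2)
      + lmPlus P .b [(l : ℝ)] [1, P.k] (2 * v) 1)
    + ((l / (2 * (P.k + 2)) : ℂ) • qZ .a
      - (l / (2 * P.r) * (2 * v * P.logq) : ℂ) • ((2 : ℂ) • pZ .b + pZ .hat)))

/-- The highest component `Ψ*_{l,l}(v)` of the type II vertex operator, with `w = q^{2v}`: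
`V⁻(w; r, r*) exp{-A_-(-l, k+1; 1, k, k+2 | w; -(k+2)/2) + A_+(-l; 2, k+2 | w; (k+2)/2)
- B_-(-l, k+1; 1, 1, k | w; -1) + B_+(-l; 1, 1 | w) - C_-(-l; 1, 1 | w) + C_+(-l; 1, 1 | w)}
exp{l q_a / (2(k+2)) + l (q_b + q_c) - l q̂ + (l / 2r*) p̂ ln w}`, normal ordered. -/
def PsiStar (P : Params) (l : ℕ) (v : ℂ) : Op :=
  nexp P (logVMinus P l (2 * v)
    + (-lmMinus P .a [-(l : ℝ), P.k + 1] [1, P.k, P.k + 2] (2 * v) (-((P.k + 2) / 2))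
      + lmPlus P .a [-(l : ℝ)] [2, P.k + 2] (2 * v) ((P.k + 2) / 2)
      - lmMinus P .b [-(l : ℝ), P.k + 1] [1, 1, P.k] (2 * v) (-1)
      + lmPlus P .b [-(l : ℝ)] [1, 1] (2 * v) 0
      - lmMinus P .c [-(l : ℝ)] [1, 1] (2 * v) 0
      + lmPlus P .c [-(l : ℝ)] [1, 1] (2 * v) 0)
    + ((l / (2 * (P.k + 2)) : ℂ) • qZ .a + (l : ℂ) • (qZ .b + qZ .c) - (l : ℂ) • qZ .hat
      + (l / (2 * P.rs) * (2 * v * P.logq) : ℂ) • pZ .hat))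

/-! ### Exchange relations -/

/-- The exchange relation `X(u) Y(v) = (num(u, v) / den(u, v)) Y(v) X(u)`, in the usual sense of
analytic continuation. Every matrix element of `X(u) Y(v)`, that is, the sum over all intermediate
basis vectors, converges absolutely for `|w / z|` small, and every matrix element of `Y(v) X(u)`
converges absolutely for `|z / w|` small (`z = q^{2u}`, `w = q^{2v}`). Both extend to meromorphic
functions of `(u, v) ∈ ℂ²`, namely quotients `N₁ / D₁` and `N₂ / D₂` of entire functions, and these
meromorphic functions satisfy `N₁ / D₁ = (num / den) (N₂ / D₂)`. -/
def ExchangeRel (P : Params) (X Y : ℂ → Op) (num den : ℂ → ℂ → ℂ) : Prop :=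
  ∃ ρ : ℝ, 0 < ρ ∧ ∀ i j : Idx, ∃ N₁ D₁ N₂ D₂ : ℂ × ℂ → ℂ,
    Differentiable ℂ N₁ ∧ Differentiable ℂ D₁ ∧ Differentiable ℂ N₂ ∧ Differentiable ℂ D₂ ∧
    D₁ ≠ 0 ∧ D₂ ≠ 0 ∧
    (∀ u v : ℂ, ‖qpow P (2 * v) / qpow P (2 * u)‖ < ρ →
      Summable (fun m : Idx => X u i m * Y v m j) ∧
      D₁ (u, v) * ∑' m : Idx, X u i m * Y v m j = N₁ (u, v)) ∧
    (∀ u v : ℂ, ‖qpow P (2 * u) / qpow P (2 * v)‖ < ρ →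
      Summable (fun m : Idx => Y v i m * X u m j) ∧
      D₂ (u, v) * ∑' m : Idx, Y v i m * X u m j = N₂ (u, v)) ∧
    (∃ u v : ℂ, den u v ≠ 0) ∧
    ∀ u v : ℂ, den u v * (N₁ (u, v) * D₂ (u, v)) = num u v * (N₂ (u, v) * D₁ (u, v))

end

end EllipticSl2

/-! Each current and vertex operator is a normal ordered exponential `nexp P X` or, for `E` and `F`,
a scalar times a difference of two. Moving the annihilation part of the left factor past the
creation part of the right one gives :e^A: :e^B: = e^⟨AB⟩ :e^(A+B):, where the scalar ⟨AB⟩ collects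
the contractions of oscillators and zero modes (`hasSum_nexp_mul_nexp`). The operator :e^(A+B): is
the same for both orders, so the exchange factor is the quotient of e^⟨AB⟩ and e^⟨BA⟩ after analytic
continuation (`exchangeRel_nexp`).

The oscillator contraction is a power series in w/z. Summed over the bosons a, b, c, its
coefficients are either 0 or [mn]/[νn] q^(βn)/n, with m = -l, ν = r for Φ and m = l, ν = r* for Ψ*
(`sum_oscContr_logPhi`, `sum_oscContr_logPsiStar`). The second kind exponentiates to a quotient of
two infinite products in base t = q^(2ν), which provides the continuation (`exp_contraction`). The
opposite order yields the same with w/z inverted and β negated. The products of the two orders pair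
up as (x;t)_∞ (t/x;t)_∞ in two theta functions, and the zero modes supply the quotient of their
Gaussian prefactors (`exchangeRel_nexp_theta`). When the exchange factor is not 1, the two summands
of `E` or `F` have β = ν and β = -ν; both give the same theta quotient because θ is odd, so the
relation passes to their difference.

A matrix element of a product is a sum over infinitely many intermediate vectors. On polynomials in
the creation operators the exponential of an annihilation operator is a translation, and the sum
over occupation numbers becomes an exponential series in infinitely many variables, absolutely
convergent as soon as the contraction is (`hasSum_dpow`). Geometric growth of the field coefficients
ensures this for small |w/z|. -/

namespace EllipticSl2

open Finset

/-! ### Divided powers with multi-exponents -/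

section DividedPowers

variable {ι : Type*} {R : Type*} [CommRing R] [Algebra ℂ R]

/-- The divided power `∏ fᵢ ^ eᵢ / eᵢ!`. -/
noncomputable def dpow (f : ι → R) (e : ι →₀ ℕ) : R :=
  e.prod fun i t => (t.factorial : ℂ)⁻¹ • f i ^ t

@[simp] lemma dpow_zero (f : ι → R) : dpow f 0 = 1 := by simp [dpow]

lemma dpow_add_single (f : ι → R) (e : ι →₀ ℕ) (i : ι) :
    ((e i : ℂ) + 1) • dpow f (e + Finsupp.single i 1) = f i * dpow f e := by
  classical
  have h1 : ∀ j : ι, ((Nat.factorial 0 : ℕ) : ℂ)⁻¹ • f j ^ 0 = 1 := by simp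
  have he : (e + Finsupp.single i 1).erase i = e.erase i := by
    ext j
    by_cases h : j = i <;> simp [h, Finsupp.erase, Finsupp.single_apply, Ne.symm]
  rw [dpow, dpow, ← Finsupp.mul_prod_erase' _ i _ h1, he, ← Finsupp.mul_prod_erase' e i _ h1,
    ← smul_mul_assoc, ← mul_assoc]
  congr 1
  have h2 : ((e i : ℂ) + 1) ≠ 0 := Nat.cast_add_one_ne_zero _
  have h3 : ((e i).factorial : ℂ) ≠ 0 := Nat.cast_ne_zero.2 (Nat.factorial_ne_zero _)
  simp only [Finsupp.add_apply, Finsupp.single_eq_same, Nat.factorial_succ, smul_smul, pow_succ',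
    Nat.cast_mul, Nat.cast_add, Nat.cast_one, mul_smul_comm]
  congr 1
  field_simp

/-- The recursion is the coefficientwise form of the differential equations ∂ᵢF = fᵢF. With constant
term 1 it has only one solution, by induction on the degree, since eᵢ + 1 is invertible. -/
lemma eq_dpow {f : ι → R} {L : (ι →₀ ℕ) → R} (h0 : L 0 = 1)
    (h : ∀ e i, ((e i : ℂ) + 1) • L (e + Finsupp.single i 1) = f i * L e) : L = dpow f := by
  classical
  funext e
  induction hn : e.degree generalizing e with
  | zero => rw [(Finsupp.degree_eq_zero_iff e).1 hn, h0, dpow_zero]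
  | succ n ih =>
    have hne : e ≠ 0 := by rintro rfl; simp at hn
    obtain ⟨i, hi⟩ := Finsupp.ne_iff.1 hne
    have hle : Finsupp.single i 1 ≤ e := by
      simpa [Finsupp.single_le_iff] using Nat.one_le_iff_ne_zero.2 hi
    have he : e - Finsupp.single i 1 + Finsupp.single i 1 = e := tsub_add_cancel_of_le hle
    set e' := e - Finsupp.single i 1 with he'
    have hd : e'.degree = n := by
      have := congrArg Finsupp.degree he
      rw [map_add, Finsupp.degree_single] at this
      omega
    have h2 : ((e' i : ℂ) + 1) ≠ 0 := Nat.cast_add_one_ne_zero _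
    have := (h e' i).trans ((congrArg (f i * ·) (ih e' hd)).trans (dpow_add_single f e' i).symm)
    rw [he] at this
    exact smul_right_injective R h2 this

/-- The exponential generating series `exp (∑ fᵢ yᵢ)` of the divided powers. -/
noncomputable def dpowSeries (f : ι → R) : MvPowerSeries ι R := dpow f

lemma coeff_dpowSeries (f : ι → R) (e : ι →₀ ℕ) :
    MvPowerSeries.coeff e (dpowSeries f) = dpow f e := rfl

lemma pderiv_dpowSeries (f : ι → R) (i : ι) :
    MvPowerSeries.pderiv R i (dpowSeries f) = MvPowerSeries.C (f i) * dpowSeries f := by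
  ext e
  rw [MvPowerSeries.coeff_pderiv, MvPowerSeries.coeff_C_mul, coeff_dpowSeries, coeff_dpowSeries,
    ← dpow_add_single f e i, Algebra.smul_def, map_add, map_natCast, map_one, mul_comm]

/-- By the Leibniz rule the product solves ∂ᵢF = (fᵢ + gᵢ)F with constant term 1, and `eq_dpow`
gives uniqueness. -/
lemma dpowSeries_add (f g : ι → R) : dpowSeries (f + g) = dpowSeries f * dpowSeries g := by
  classical
  refine (eq_dpow (L := dpowSeries f * dpowSeries g) ?_ fun e i => ?_).symm
  · have := MvPowerSeries.coeff_mul (0 : ι →₀ ℕ) (dpowSeries f) (dpowSeries g)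
    refine Eq.trans this ?_
    simp [coeff_dpowSeries, -MvPowerSeries.coeff_zero_eq_constantCoeff]
  · have h := congrArg (MvPowerSeries.coeff e) (Derivation.leibniz (MvPowerSeries.pderiv R i)
      (dpowSeries f) (dpowSeries g))
    rw [pderiv_dpowSeries, pderiv_dpowSeries, MvPowerSeries.coeff_pderiv] at h
    rw [Algebra.smul_def, map_add, map_natCast, map_one, mul_comm]
    refine Eq.trans h ?_
    rw [show dpowSeries f • (MvPowerSeries.C (g i) * dpowSeries g)
      + dpowSeries g • (MvPowerSeries.C (f i) * dpowSeries f)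
      = MvPowerSeries.C (f i + g i) * (dpowSeries f * dpowSeries g) by
        simp only [smul_eq_mul, map_add]; ring, MvPowerSeries.coeff_C_mul]
    rfl

lemma dpow_add [DecidableEq ι] (f g : ι → R) (e : ι →₀ ℕ) :
    dpow (f + g) e = ∑ p ∈ antidiagonal e, dpow f p.1 * dpow g p.2 := by
  rw [← coeff_dpowSeries, dpowSeries_add, MvPowerSeries.coeff_mul]
  rfl

/-- The scalar `∏ 1 / eᵢ!`. -/
noncomputable def invFact (e : ι →₀ ℕ) : ℂ := e.prod fun _ t => (t.factorial : ℂ)⁻¹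

lemma invFact_ne_zero (e : ι →₀ ℕ) : invFact e ≠ 0 :=
  Finset.prod_ne_zero_iff.2 fun _ _ =>
    inv_ne_zero (Nat.cast_ne_zero.2 (Nat.factorial_ne_zero _))

lemma dpow_eq_invFact_smul (f : ι → R) (e : ι →₀ ℕ) :
    dpow f e = invFact e • e.prod fun i t => f i ^ t := by
  simp only [dpow, invFact, Finsupp.prod, Algebra.smul_def, map_prod, Finset.prod_mul_distrib]

lemma dpow_mul (f g : ι → ℂ) (e : ι →₀ ℕ) :
    dpow (fun i => f i * g i) e = dpow f e * e.prod fun i t => g i ^ t := by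
  simp only [dpow, Finsupp.prod, ← Finset.prod_mul_distrib]
  refine Finset.prod_congr rfl fun i _ => ?_
  rw [mul_pow, smul_mul_assoc]

end DividedPowers

/-! ### Exponentials of creation and annihilation operators -/

lemma creExp_eq_dpowSeries (f : Mode → ℂ) : creExp f = dpowSeries f := by
  funext e
  simp only [creExp, dpowSeries, dpow, smul_eq_mul, div_eq_inv_mul]

lemma creExp_add (f g : Mode → ℂ) : creExp (f + g) = creExp f * creExp g := by
  simp only [creExp_eq_dpowSeries, dpowSeries_add]

lemma coeff_creExp (f : Mode → ℂ) (e : Occ) : MvPowerSeries.coeff e (creExp f) = dpow f e := by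
  rw [creExp_eq_dpowSeries, coeff_dpowSeries]

/-- The translation `x_{-n} ↦ x_{-n} + g(x, n)`. -/
noncomputable def translate (g : Mode → ℂ) : MvPolynomial Mode ℂ →ₐ[ℂ] MvPolynomial Mode ℂ :=
  MvPolynomial.aeval fun i => MvPolynomial.X i + MvPolynomial.C (g i)

lemma translate_translate (g h : Mode → ℂ) (p : MvPolynomial Mode ℂ) :
    translate g (translate h p) = translate (g + h) p := by
  have : (translate g).comp (translate h) = translate (g + h) := by
    ext i : 1
    simp [translate, MvPolynomial.algebraMap_eq, add_assoc]
  exact DFunLike.congr_fun this p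

/-- The truncated exponential series of an annihilation operator. -/
noncomputable def annExpTrunc (P : Params) (f : Mode → ℂ) (M : ℕ) (m : MvPolynomial Mode ℂ) :
    MvPolynomial Mode ℂ :=
  ∑ N ∈ Finset.range M,
    (N.factorial : ℂ)⁻¹ • ((annOp P f : MvPolynomial Mode ℂ →ₗ[ℂ] MvPolynomial Mode ℂ) ^ N) m

/-- The derivation D sends Xᵢ to a constant c, which D kills; hence the commutator of D^(N+1) with
multiplication by Xᵢ is (N+1) c D^N. -/
lemma annOp_pow_X_mul (P : Params) (f : Mode → ℂ) (i : Mode) (p : MvPolynomial Mode ℂ) (N : ℕ) :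
    ((annOp P f : MvPolynomial Mode ℂ →ₗ[ℂ] MvPolynomial Mode ℂ) ^ (N + 1)) (MvPolynomial.X i * p) =
      MvPolynomial.X i *
        ((annOp P f : MvPolynomial Mode ℂ →ₗ[ℂ] MvPolynomial Mode ℂ) ^ (N + 1)) p +
      ((N : ℂ) + 1) • (MvPolynomial.C (f i * oscComm P i) *
        ((annOp P f : MvPolynomial Mode ℂ →ₗ[ℂ] MvPolynomial Mode ℂ) ^ N) p) := by
  induction N with
  | zero =>
    simp only [zero_add, pow_one, pow_zero, Module.End.one_apply, Nat.cast_zero, one_smul,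
      Derivation.coeFn_coe, Derivation.leibniz, smul_eq_mul]
    simp only [annOp, MvPolynomial.mkDerivation_X]
    ring
  | succ N ih =>
    set D : MvPolynomial Mode ℂ →ₗ[ℂ] MvPolynomial Mode ℂ := ↑(annOp P f)
    have hD : ∀ x y, D (x * y) = x * D y + y * D x := fun x y => (annOp P f).leibniz x y
    have hX : D (MvPolynomial.X i) = MvPolynomial.C (f i * oscComm P i) :=
      MvPolynomial.mkDerivation_X _ _ _
    have hC : ∀ c, D (MvPolynomial.C c) = 0 := fun c => (annOp P f).map_algebraMap c
    have hs : ∀ (k : ℕ), (D ^ (k + 1)) p = D ((D ^ k) p) := fun k => by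
      rw [pow_succ', Module.End.mul_apply]
    rw [pow_succ' _ (N + 1), Module.End.mul_apply, ih, map_add, map_smul, hD, hD, hX, hC,
      Module.End.mul_apply, hs N]
    simp only [MvPolynomial.smul_eq_C_mul, map_add, map_one, Nat.cast_add,
      Nat.cast_one, map_natCast]
    ring

/-- After division by factorials the commutator term is again a truncated exponential, one term
shorter. -/
lemma annExpTrunc_X_mul (P : Params) (f : Mode → ℂ) (i : Mode) (p : MvPolynomial Mode ℂ) (M : ℕ) :
    annExpTrunc P f (M + 1) (MvPolynomial.X i * p) =
      MvPolynomial.X i * annExpTrunc P f (M + 1) p +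
        MvPolynomial.C (f i * oscComm P i) * annExpTrunc P f M p := by
  simp only [annExpTrunc]
  rw [Finset.sum_range_succ', Finset.sum_range_succ' _ M, mul_add, Finset.mul_sum, Finset.mul_sum,
    add_right_comm, ← Finset.sum_add_distrib]
  congr 1
  · refine Finset.sum_congr rfl fun N _ => ?_
    rw [annOp_pow_X_mul, smul_add, smul_smul, mul_smul_comm, mul_smul_comm]
    congr 2
    rw [Nat.factorial_succ]
    have h2 : ((N : ℂ) + 1) ≠ 0 := Nat.cast_add_one_ne_zero _
    push_cast
    field_simp
  · simp

/-- Taylor's formula: the exponential of a derivation with constant coefficients is a translation.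
Every truncation beyond the degree is allowed because peeling off a variable produces two different
truncation orders. -/
lemma annExpTrunc_monomial (P : Params) (f : Mode → ℂ) (e : Occ) (M : ℕ) (hM : e.degree < M) :
    annExpTrunc P f M (MvPolynomial.monomial e 1) =
      translate (fun i => f i * oscComm P i) (MvPolynomial.monomial e 1) := by
  induction hn : e.degree generalizing e M with
  | zero =>
    obtain ⟨M, rfl⟩ : ∃ M', M = M' + 1 := ⟨M - 1, by omega⟩
    rw [(Finsupp.degree_eq_zero_iff e).1 hn, annExpTrunc, Finset.sum_range_succ',
      Finset.sum_eq_zero]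
    · simp
    · intro N _
      rw [pow_succ, Module.End.mul_apply, MvPolynomial.monomial_zero', Derivation.coeFn_coe]
      rw [show annOp P f (MvPolynomial.C 1) = 0 from (annOp P f).map_algebraMap 1]
      simp
  | succ n ih =>
    have hne : e ≠ 0 := by rintro rfl; simp at hn
    obtain ⟨i, hi⟩ := Finsupp.ne_iff.1 hne
    have hle : Finsupp.single i 1 ≤ e := by
      simpa [Finsupp.single_le_iff] using Nat.one_le_iff_ne_zero.2 hi
    have he : Finsupp.single i 1 + (e - Finsupp.single i 1) = e := add_tsub_cancel_of_le hle
    set e' := e - Finsupp.single i 1 with he'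
    have hd : e'.degree = n := by
      have := congrArg Finsupp.degree he
      rw [map_add, Finsupp.degree_single] at this
      omega
    obtain ⟨M, rfl⟩ : ∃ M', M = M' + 1 := ⟨M - 1, by omega⟩
    have hm : (MvPolynomial.monomial e (1 : ℂ)) =
        MvPolynomial.X i * MvPolynomial.monomial e' 1 := by
      rw [MvPolynomial.X, MvPolynomial.monomial_mul, he, one_mul]
    rw [hm, annExpTrunc_X_mul, ih e' (M + 1) (by omega) hd, ih e' M (by omega) hd, map_mul,
      ← add_mul]
    simp [translate]

lemma annExp_monomial (P : Params) (f : Mode → ℂ) (e : Occ) :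
    annExp P f (MvPolynomial.monomial e 1) =
      translate (fun i => f i * oscComm P i) (MvPolynomial.monomial e 1) := by
  refine annExpTrunc_monomial P f e _ ?_
  rw [MvPolynomial.totalDegree_monomial _ one_ne_zero]
  exact Nat.lt_succ_self _

lemma translate_monomial (g : Mode → ℂ) (e : Occ) :
    translate g (MvPolynomial.monomial e 1) =
      e.prod fun i t => (MvPolynomial.X i + MvPolynomial.C (g i)) ^ t := by
  rw [translate, MvPolynomial.aeval_monomial, map_one, one_mul]

lemma dpow_X (e : Occ) :
    dpow (MvPolynomial.X : Mode → MvPolynomial Mode ℂ) e =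
      MvPolynomial.monomial e (invFact e) := by
  rw [MvPolynomial.monomial_eq, dpow_eq_invFact_smul, MvPolynomial.smul_eq_C_mul]

lemma dpow_C (g : Mode → ℂ) (e : Occ) :
    dpow (fun i => (MvPolynomial.C (g i) : MvPolynomial Mode ℂ)) e =
      MvPolynomial.C (dpow g e) := by
  simp only [dpow, Finsupp.prod, map_prod, MvPolynomial.smul_eq_C_mul, map_mul, map_pow,
    smul_eq_mul]

open scoped Classical in
/-- The coefficients of a translated monomial. -/
lemma coeff_translate_monomial (g : Mode → ℂ) (c e : Occ) :
    invFact e * MvPolynomial.coeff c (translate g (MvPolynomial.monomial e 1)) =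
      if c ≤ e then invFact c * dpow g (e - c) else 0 := by
  have h : invFact e • translate g (MvPolynomial.monomial e 1) =
      dpow ((MvPolynomial.X : Mode → MvPolynomial Mode ℂ) + fun i => MvPolynomial.C (g i)) e := by
    rw [dpow_eq_invFact_smul, translate_monomial]
    rfl
  -- The addition formula for divided powers, applied to X + g, leaves only the splitting (c, e - c)
  -- in the coefficient of c.
  rw [← smul_eq_mul, ← MvPolynomial.coeff_smul, h, dpow_add, MvPolynomial.coeff_sum]
  simp only [dpow_X, dpow_C, mul_comm _ (MvPolynomial.C _), MvPolynomial.coeff_C_mul,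
    MvPolynomial.coeff_monomial]
  split_ifs with hc
  · rw [Finset.sum_eq_single (c, e - c)]
    · simp [mul_comm]
    · rintro ⟨a, b⟩ hab hne
      rw [HasAntidiagonal.mem_antidiagonal] at hab
      rw [if_neg, mul_zero]
      rintro rfl
      exact hne (by rw [← hab]; simp)
    · intro hn
      exact absurd (HasAntidiagonal.mem_antidiagonal.2 (add_tsub_cancel_of_le hc)) hn
  · refine Finset.sum_eq_zero ?_
    rintro ⟨a, b⟩ hab
    rw [HasAntidiagonal.mem_antidiagonal] at hab
    rw [if_neg, mul_zero]
    rintro rfl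
    exact hc (by rw [← hab]; simp)

end EllipticSl2

namespace EllipticSl2

open Filter Topology

/-! ### Sums over all multi-exponents -/

section Sums

variable {ι : Type*}

/-- Distributivity over a finite box of exponents. The condition h i 0 = 1 makes indices of T
outside the support harmless. -/
lemma sum_finsupp_prod {R : Type*} [CommSemiring R] (T : Finset ι) (s : ι → Finset ℕ)
    (h : ι → ℕ → R) (h0 : ∀ i, h i 0 = 1) :
    ∑ e ∈ T.finsupp s, e.prod h = ∏ i ∈ T, ∑ n ∈ s i, h i n := by
  classical
  rw [Finset.prod_sum, Finset.finsupp, Finset.sum_map]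
  refine Finset.sum_congr rfl fun f _ => ?_
  rw [Function.Embedding.coeFn_mk, Finsupp.prod_of_support_subset _
    (Finsupp.support_indicator_subset T f) _ fun i _ => h0 i, ← Finset.prod_attach]
  refine Finset.prod_congr rfl fun i _ => ?_
  rw [Finsupp.indicator_of_mem i.2]

lemma norm_dpow (t : ι → ℂ) (e : ι →₀ ℕ) :
    ‖dpow t e‖ = e.prod fun i n => ‖t i‖ ^ n / (n.factorial : ℝ) := by
  simp [dpow, Finsupp.prod, div_eq_inv_mul]

lemma summable_norm_dpow {t : ι → ℂ} (ht : Summable fun i => ‖t i‖) :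
    Summable fun e : ι →₀ ℕ => ‖dpow t e‖ := by
  classical
  refine summable_of_sum_le (c := Real.exp (∑' i, ‖t i‖)) (fun _ => norm_nonneg _) fun u => ?_
  -- Every finite family of exponents lies in a box: T contains all supports and N exceeds all
  -- degrees. On the box the sum factors into truncated exponential series.
  set T : Finset ι := u.biUnion Finsupp.support
  set N : ℕ := u.sup (fun e => e.degree) + 1
  have hsub : u ⊆ T.finsupp fun _ => Finset.range N := by
    intro e he
    refine Finset.mem_finsupp_iff.2 ⟨Finset.subset_biUnion_of_mem Finsupp.support he, fun i _ => ?_⟩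
    rw [Finset.mem_range, Nat.lt_succ_iff]
    exact (Finsupp.le_degree i e).trans (Finset.le_sup (f := fun e : ι →₀ ℕ => e.degree) he)
  calc ∑ e ∈ u, ‖dpow t e‖ ≤ ∑ e ∈ T.finsupp fun _ => Finset.range N, ‖dpow t e‖ :=
        Finset.sum_le_sum_of_subset_of_nonneg hsub fun _ _ _ => norm_nonneg _
    _ = ∏ i ∈ T, ∑ n ∈ Finset.range N, ‖t i‖ ^ n / (n.factorial : ℝ) := by
        simp only [norm_dpow]
        exact sum_finsupp_prod T _ _ fun i => by simp
    _ ≤ ∏ i ∈ T, Real.exp ‖t i‖ :=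
        Finset.prod_le_prod (fun i _ => Finset.sum_nonneg fun n _ => by positivity)
          fun i _ => Real.sum_le_exp_of_nonneg (norm_nonneg _) N
    _ = Real.exp (∑ i ∈ T, ‖t i‖) := (Real.exp_sum _ _).symm
    _ ≤ _ := Real.exp_le_exp.2 (ht.sum_le_tsum T fun _ _ => norm_nonneg _)

/-- The identity e^(∑ tᵢ) = ∏ e^(tᵢ), expanded. Two limits by dominated convergence: the height of
the box tends to infinity over a fixed finite T, then T exhausts the index set. `summable_norm_dpow`
supplies the dominating function. -/
lemma hasSum_dpow {t : ι → ℂ} (ht : Summable fun i => ‖t i‖) :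
    HasSum (dpow t) (Complex.exp (∑' i, t i)) := by
  classical
  have hs := summable_norm_dpow ht
  have hA : ∀ T : Finset ι, (∑' e : ι →₀ ℕ, if e.support ⊆ T then dpow t e else 0) =
      ∏ i ∈ T, Complex.exp (t i) := by
    intro T
    have h1 : Tendsto (fun N : ℕ => ∑' e : ι →₀ ℕ,
        if e ∈ T.finsupp (fun _ => Finset.range N) then dpow t e else 0) atTop
        (𝓝 (∑' e : ι →₀ ℕ, if e.support ⊆ T then dpow t e else 0)) := by
      refine tendsto_tsum_of_dominated_convergence hs (fun e => ?_)
        (Eventually.of_forall fun N e => ?_)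
      · refine tendsto_const_nhds.congr' ?_
        filter_upwards [eventually_gt_atTop e.degree] with N hN
        refine if_congr ⟨fun h => Finset.mem_finsupp_iff.2 ⟨h, fun i _ => ?_⟩,
          fun h => (Finset.mem_finsupp_iff.1 h).1⟩ rfl rfl
        exact Finset.mem_range.2 ((Finsupp.le_degree i e).trans_lt hN)
      · split_ifs <;> simp
    have h2 : ∀ N : ℕ, (∑' e : ι →₀ ℕ,
        if e ∈ T.finsupp (fun _ => Finset.range N) then dpow t e else 0) =
        ∏ i ∈ T, ∑ n ∈ Finset.range N, (n.factorial : ℂ)⁻¹ • t i ^ n := by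
      intro N
      rw [tsum_eq_sum (s := T.finsupp fun _ => Finset.range N) fun e he => if_neg he,
        Finset.sum_congr rfl fun e he => if_pos he]
      exact sum_finsupp_prod T _ _ fun i => by simp
    simp only [h2] at h1
    refine tendsto_nhds_unique h1 (tendsto_finsetProd _ fun i _ => ?_)
    have := (NormedSpace.exp_series_hasSum_exp' (𝕂 := ℂ) (t i)).tendsto_sum_nat
    rwa [← Complex.exp_eq_exp_ℂ] at this
  have h1 : Tendsto (fun T : Finset ι => ∑' e : ι →₀ ℕ,
      if e.support ⊆ T then dpow t e else 0) atTop (𝓝 (∑' e, dpow t e)) := by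
    refine tendsto_tsum_of_dominated_convergence hs (fun e => ?_)
      (Eventually.of_forall fun N e => ?_)
    · refine tendsto_const_nhds.congr' ?_
      filter_upwards [eventually_ge_atTop e.support] with T hT
      exact (if_pos hT).symm
    · split_ifs <;> simp
  have h2 : Tendsto (fun T : Finset ι => ∏ i ∈ T, Complex.exp (t i)) atTop
      (𝓝 (Complex.exp (∑' i, t i))) := by
    simp only [← Complex.exp_sum]
    exact (Complex.continuous_exp.tendsto _).comp ht.of_norm.hasSum
  simp only [hA] at h1
  rw [← tendsto_nhds_unique h1 h2]
  exact hs.of_norm.hasSum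

end Sums

/-! ### Products of normal ordered exponentials -/

/-- Only exponents e ≥ c contribute. After the shift e = c + e' the factor G^c separates and the
exponential series of the products gᵢGᵢ remains. -/
lemma hasSum_coeff_translate {g G : Mode → ℂ} (h : Summable fun i => ‖g i * G i‖) (c : Occ) :
    HasSum (fun e : Occ => MvPolynomial.coeff c (translate g (MvPolynomial.monomial e 1)) *
      dpow G e) (Complex.exp (∑' i, g i * G i) * dpow G c) := by
  classical
  have hf : ∀ e : Occ, MvPolynomial.coeff c (translate g (MvPolynomial.monomial e 1)) * dpow G e =
      (if c ≤ e then invFact c * dpow g (e - c) else 0) * e.prod fun i t => G i ^ t := by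
    intro e
    rw [dpow_eq_invFact_smul, smul_eq_mul, ← coeff_translate_monomial]
    ring
  simp only [hf]
  rw [← (add_right_injective c).hasSum_iff]
  · have h1 := (hasSum_dpow h).mul_right (dpow G c)
    refine h1.congr_fun fun e => ?_
    simp only [Function.comp_apply, le_add_iff_nonneg_right, zero_le, if_true,
      add_tsub_cancel_left]
    rw [dpow_mul, Finsupp.prod_add_index' (fun i => pow_zero _) fun i => pow_add _,
      dpow_eq_invFact_smul G, smul_eq_mul]
    ring
  · intro e he
    rw [if_neg, zero_mul]
    exact fun hc => he ⟨e - c, add_tsub_cancel_of_le hc⟩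

lemma hasSum_mul_translate {g G : Mode → ℂ} (h : Summable fun i => ‖g i * G i‖)
    (Q : MvPowerSeries Mode ℂ) (i : Occ) :
    HasSum (fun e : Occ => MvPowerSeries.coeff i
        (Q * ((translate g (MvPolynomial.monomial e 1) : MvPolynomial Mode ℂ) :
          MvPowerSeries Mode ℂ)) * dpow G e)
      (Complex.exp (∑' i, g i * G i) * MvPowerSeries.coeff i (Q * creExp G)) := by
  classical
  simp only [MvPowerSeries.coeff_mul, Finset.mul_sum, Finset.sum_mul]
  refine hasSum_sum fun p _ => ?_
  rw [coeff_creExp, mul_left_comm]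
  refine ((hasSum_coeff_translate h p.2).mul_left (MvPowerSeries.coeff p.1 Q)).congr_fun
    fun e => ?_
  rw [MvPolynomial.coeff_coe, mul_assoc]

/-- The matrix form of moving exp(annihilation) past exp(creation): the cost is the scalar exp(∑
gᵢGᵢ), and what stands to the right is translated. The prefactor Q is arbitrary so that it can carry
the outer creation exponential and absorb monomials of p. -/
lemma hasSum_creExp_mul {g G : Mode → ℂ} (h : Summable fun i => ‖g i * G i‖)
    (Q : MvPowerSeries Mode ℂ) (i : Occ) (p : MvPolynomial Mode ℂ) :
    HasSum (fun e : Occ => MvPowerSeries.coeff i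
        (Q * ((translate g (MvPolynomial.monomial e 1) : MvPolynomial Mode ℂ) :
          MvPowerSeries Mode ℂ)) *
        MvPowerSeries.coeff e (creExp G * (p : MvPowerSeries Mode ℂ)))
      (Complex.exp (∑' i, g i * G i) *
        MvPowerSeries.coeff i (Q * (creExp G *
          ((translate g p : MvPolynomial Mode ℂ) : MvPowerSeries Mode ℂ)))) := by
  classical
  induction p using MvPolynomial.induction_on' with
  | add p q hp hq =>
    simp only [map_add, MvPolynomial.coe_add, mul_add]
    exact hp.add hq
  | monomial d a =>
    -- Multiplication by the monomial d restricts the sum to e ≥ d. Translation is multiplicative,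
    -- so the translated monomial joins Q.
    rw [← (add_right_injective d).hasSum_iff]
    · have h1 := (hasSum_mul_translate h (Q *
        ((translate g (MvPolynomial.monomial d 1) : MvPolynomial Mode ℂ) :
          MvPowerSeries Mode ℂ)) i).mul_left a
      have hm : MvPolynomial.monomial d a = MvPolynomial.C a * MvPolynomial.monomial d 1 := by
        rw [MvPolynomial.C_mul_monomial, mul_one]
      have h2 : Complex.exp (∑' i, g i * G i) * MvPowerSeries.coeff i (Q * (creExp G *
          ((translate g (MvPolynomial.monomial d a) : MvPolynomial Mode ℂ) :
            MvPowerSeries Mode ℂ))) = a * (Complex.exp (∑' i, g i * G i) *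
          MvPowerSeries.coeff i (Q *
            ((translate g (MvPolynomial.monomial d 1) : MvPolynomial Mode ℂ) :
              MvPowerSeries Mode ℂ) * creExp G)) := by
        rw [hm, map_mul (translate g), MvPolynomial.coe_mul,
          show translate g (MvPolynomial.C a) = MvPolynomial.C a from
            (translate g).commutes a, MvPolynomial.coe_C, mul_left_comm a,
          ← MvPowerSeries.coeff_C_mul _ _ a]
        congr 2
        ring
      rw [h2]
      refine h1.congr_fun fun e => ?_
      rw [Function.comp_apply, MvPolynomial.coe_monomial, add_comm d e,
        MvPowerSeries.coeff_add_mul_monomial, coeff_creExp,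
        show MvPolynomial.monomial (e + d) (1 : ℂ) =
          MvPolynomial.monomial d 1 * MvPolynomial.monomial e 1 by
            rw [MvPolynomial.monomial_mul, mul_one, add_comm],
        map_mul (translate g), MvPolynomial.coe_mul, ← mul_assoc Q]
      ring
    · intro e he
      rw [MvPolynomial.coe_monomial, MvPowerSeries.coeff_mul_monomial, if_neg, mul_zero]
      exact fun hc => he ⟨e - d, add_tsub_cancel_of_le hc⟩

/-- The exponent contributed by the zero modes to a matrix element of `:exp X:`. -/
noncomputable def zeroExponent (P : Params) (X : Boselin) (μ : ZeroMode → ℂ) : ℂ :=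
  X .one + X (.p .a) * (zeroComm P .a * μ .a) + X (.p .b) * (zeroComm P .b * μ .b)
    + X (.p .c) * (zeroComm P .c * μ .c) + X (.p .hat) * (zeroComm P .hat * μ .hat)

/-- The matrix elements of the oscillator part `exp(X_cre) exp(X_ann)` of `:exp X:`. -/
noncomputable def oscMatrix (P : Params) (X : Boselin) (i j : Occ) : ℂ :=
  MvPowerSeries.coeff i (creExp (fun m => X (.cre m)) *
    ((translate (fun m => X (.ann m) * oscComm P m) (MvPolynomial.monomial j 1) :
      MvPolynomial Mode ℂ) : MvPowerSeries Mode ℂ))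

open scoped Classical in
lemma nexp_apply (P : Params) (X : Boselin) (i j : Idx) :
    nexp P X i j = if i.1 = (fun x => j.1 x + X (.q x)) then
      Complex.exp (zeroExponent P X j.1) * oscMatrix P X i.2 j.2 else 0 := by
  rw [nexp, annExp_monomial]
  rfl

/-- The contraction of the oscillators of `A` and `B`, mode by mode. -/
noncomputable def oscContr (P : Params) (A B : Boselin) (m : Mode) : ℂ :=
  A (.ann m) * oscComm P m * B (.cre m)

/-- The contraction of the zero modes of `A` and `B`. -/
noncomputable def zeroContr (P : Params) (A B : Boselin) : ℂ :=
  A (.p .a) * (zeroComm P .a * B (.q .a)) + A (.p .b) * (zeroComm P .b * B (.q .b))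
    + A (.p .c) * (zeroComm P .c * B (.q .c)) + A (.p .hat) * (zeroComm P .hat * B (.q .hat))

lemma hasSum_oscMatrix {P : Params} {A B : Boselin}
    (h : Summable fun m => ‖oscContr P A B m‖) (i j : Occ) :
    HasSum (fun e => oscMatrix P A i e * oscMatrix P B e j)
      (Complex.exp (∑' m, oscContr P A B m) * oscMatrix P (A + B) i j) := by
  have h1 := hasSum_creExp_mul (g := fun m => A (.ann m) * oscComm P m)
    (G := fun m => B (.cre m)) h (creExp fun m => A (.cre m)) i
    (translate (fun m => B (.ann m) * oscComm P m) (MvPolynomial.monomial j 1))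
  rw [translate_translate, ← mul_assoc (creExp _), ← creExp_add] at h1
  have h2 : ((fun m => A (.ann m) * oscComm P m) + fun m => B (.ann m) * oscComm P m) =
      fun m => (A + B) (.ann m) * oscComm P m := by
    funext m
    simp only [Pi.add_apply, add_mul]
  rw [h2] at h1
  exact h1

/-- The momenta in A are read off after B has shifted the weight μ; the effect of this shift is
exactly `zeroContr`. -/
lemma zeroExponent_mul (P : Params) (A B : Boselin) (μ : ZeroMode → ℂ) :
    zeroExponent P A (fun x => μ x + B (.q x)) + zeroExponent P B μ =
      zeroContr P A B + zeroExponent P (A + B) μ := by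
  simp only [zeroExponent, zeroContr, Pi.add_apply]
  ring

/-- The product of two normal ordered exponentials. -/
lemma hasSum_nexp_mul_nexp {P : Params} {A B : Boselin}
    (h : Summable fun m => ‖oscContr P A B m‖) (i j : Idx) :
    HasSum (fun m => nexp P A i m * nexp P B m j)
      (Complex.exp (∑' m, oscContr P A B m) * Complex.exp (zeroContr P A B) *
        nexp P (A + B) i j) := by
  classical
  set μ : ZeroMode → ℂ := fun x => j.1 x + B (.q x) with hμ
  -- B sends the weight of j to the single weight μ, so the sum over intermediate basis vectors
  -- reduces to a sum over occupations.
  have hinj : Function.Injective fun e : Occ => ((μ, e) : Idx) :=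
    fun e e' h => (Prod.ext_iff.1 h).2
  rw [← hinj.hasSum_iff]
  · have hc : (i.1 = fun x => μ x + A (.q x)) ↔ i.1 = fun x => j.1 x + (A + B) (.q x) := by
      simp only [hμ, Pi.add_apply, add_assoc, add_comm (A _)]
    simp only [Function.comp_def, nexp_apply, hc]
    by_cases hi : i.1 = fun x => j.1 x + (A + B) (.q x)
    · simp only [if_pos hi, hμ, if_true]
      have hz := congrArg Complex.exp (zeroExponent_mul P A B j.1)
      rw [Complex.exp_add, Complex.exp_add] at hz
      have h1 := (hasSum_oscMatrix h i.2 j.2).mul_left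
        (Complex.exp (zeroExponent P A fun x => j.1 x + B (.q x)) *
          Complex.exp (zeroExponent P B j.1))
      convert! h1 using 1
      · funext e
        ring
      · rw [hz]
        ring
    · simp only [if_neg hi, zero_mul, mul_zero]
      exact hasSum_zero
  · rintro ⟨ν, e⟩ hne
    rw [nexp_apply P B, if_neg, mul_zero]
    rintro rfl
    exact hne ⟨e, rfl⟩

end EllipticSl2

namespace EllipticSl2

open Filter Topology

/-! ### The infinite products `(z; t)_∞` -/

lemma multipliable_qPoch (z : ℂ) {t : ℂ} (ht : ‖t‖ < 1) :
    Multipliable fun n : ℕ => 1 - z * t ^ n := by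
  have h : Summable fun n : ℕ => ‖-(z * t ^ n)‖ := by
    simp only [norm_neg, norm_mul, norm_pow]
    exact (summable_geometric_of_lt_one (norm_nonneg t) ht).mul_left _
  simpa only [sub_eq_add_neg] using multipliable_one_add_of_summable h

lemma differentiable_qPoch {t : ℂ} (ht : ‖t‖ < 1) : Differentiable ℂ fun z => qPoch z t := by
  intro z
  set K : Set ℂ := Metric.ball 0 (‖z‖ + 1)
  have hK : IsOpen K := Metric.isOpen_ball
  have hz : z ∈ K := by simp [K]
  have hu : Summable fun n : ℕ => (‖z‖ + 1) * ‖t‖ ^ n :=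
    (summable_geometric_of_lt_one (norm_nonneg t) ht).mul_left _
  have h := Summable.hasProdLocallyUniformlyOn_nat_one_add (f := fun (n : ℕ) (x : ℂ) => -(x * t ^ n))
    hK hu (Eventually.of_forall fun n x hx => by
      rw [norm_neg, norm_mul, norm_pow]
      have : ‖x‖ ≤ ‖z‖ + 1 := (mem_ball_zero_iff.1 hx).le
      gcongr) (fun n => by fun_prop)
  have hd : DifferentiableOn ℂ (fun x => ∏' n : ℕ, (1 + -(x * t ^ n))) K := by
    refine TendstoLocallyUniformlyOn.differentiableOn h (Eventually.of_forall fun s => ?_) hK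
    have : Differentiable ℂ fun x : ℂ => ∏ n ∈ s, (1 + -(x * t ^ n)) := by fun_prop
    exact this.differentiableOn
  have := hd.differentiableAt (hK.mem_nhds hz)
  simpa only [qPoch, sub_eq_add_neg] using this

lemma qPoch_eq_mul (z : ℂ) {t : ℂ} (ht : ‖t‖ < 1) :
    qPoch z t = (1 - z) * qPoch (t * z) t := by
  have e : ∀ n : ℕ, z * t ^ (n + 1) = t * z * t ^ n := fun n => by ring
  have h : Multipliable fun n : ℕ => 1 - z * t ^ (n + 1) := by
    simp only [e]
    exact multipliable_qPoch (t * z) ht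
  have h1 : ∏' n : ℕ, (1 - z * t ^ n) = (1 - z * t ^ 0) * ∏' n : ℕ, (1 - z * t ^ (n + 1)) :=
    tprod_eq_zero_mul' h
  simp only [e, pow_zero, mul_one] at h1
  exact h1

lemma hasSum_pnat_log {z : ℂ} (hz : ‖z‖ < 1) :
    HasSum (fun n : ℕ+ => z ^ (n : ℕ) / (n : ℕ)) (-Complex.log (1 - z)) := by
  have := Complex.hasSum_taylorSeries_neg_log hz
  rw [← PNat.coe_injective.hasSum_iff] at this
  · exact this
  · intro n hn
    have : n = 0 := by
      by_contra h
      exact hn ⟨⟨n, Nat.pos_of_ne_zero h⟩, rfl⟩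
    simp [this]

lemma summable_pnat_pow {x : ℝ} (h0 : 0 ≤ x) (h1 : x < 1) : Summable fun n : ℕ+ => x ^ (n : ℕ) :=
  (summable_geometric_of_lt_one h0 h1).comp_injective PNat.coe_injective

lemma summable_qPoch_double {z t : ℂ} (hz : ‖z‖ < 1) (ht : ‖t‖ < 1) :
    Summable fun p : ℕ × ℕ+ => (z * t ^ p.1) ^ (p.2 : ℕ) / (p.2 : ℕ) := by
  have h := (summable_geometric_of_lt_one (norm_nonneg t) ht).mul_of_nonneg
    (summable_pnat_pow (norm_nonneg z) hz) (fun n => by positivity) (fun n => by positivity)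
  refine Summable.of_norm_bounded h fun p => ?_
  obtain ⟨j, n⟩ := p
  have hn : (1 : ℝ) ≤ (n : ℕ) := by exact_mod_cast n.pos
  simp only [norm_div, norm_pow, norm_mul, Complex.norm_natCast]
  refine (div_le_self (by positivity) hn).trans ?_
  rw [mul_pow, mul_comm]
  refine mul_le_mul_of_nonneg_right ?_ (by positivity)
  exact pow_le_of_le_one (by positivity) (pow_le_one₀ (norm_nonneg _) ht.le) n.pos.ne'

lemma hasSum_qPoch_inner {t : ℂ} (z : ℂ) (ht : ‖t‖ < 1) (n : ℕ+) :
    HasSum (fun j : ℕ => (z * t ^ j) ^ (n : ℕ) / (n : ℕ))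
      (z ^ (n : ℕ) / ((n : ℕ) * (1 - t ^ (n : ℕ)))) := by
  have h : ‖t ^ (n : ℕ)‖ < 1 := by
    rw [norm_pow]
    exact pow_lt_one₀ (norm_nonneg _) ht n.pos.ne'
  have := (hasSum_geometric_of_norm_lt_one h).mul_left (z ^ (n : ℕ) / (n : ℕ))
  rw [← div_eq_mul_inv, div_div] at this
  refine this.congr_fun fun j => ?_
  rw [mul_pow, ← pow_mul, ← pow_mul, mul_comm j]
  ring

lemma summable_qPoch_log {z t : ℂ} (hz : ‖z‖ < 1) (ht : ‖t‖ < 1) :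
    Summable fun n : ℕ+ => z ^ (n : ℕ) / ((n : ℕ) * (1 - t ^ (n : ℕ))) := by
  have h := (summable_qPoch_double hz ht).prod_symm.prod
  refine h.congr fun n => ?_
  exact (hasSum_qPoch_inner z ht n).tsum_eq

lemma norm_mul_pow_lt_one {z t : ℂ} (hz : ‖z‖ < 1) (ht : ‖t‖ < 1) (j : ℕ) : ‖z * t ^ j‖ < 1 := by
  rw [norm_mul, norm_pow]
  exact mul_lt_one_of_nonneg_of_lt_one_left (norm_nonneg _) hz (pow_le_one₀ (norm_nonneg _) ht.le)

/-- Expand each log(1 - z t^j) in powers of z, interchange the absolutely convergent sums, and sum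
the geometric series in j. -/
lemma qPoch_eq_exp {z t : ℂ} (hz : ‖z‖ < 1) (ht : ‖t‖ < 1) :
    qPoch z t = Complex.exp (-∑' n : ℕ+, z ^ (n : ℕ) / ((n : ℕ) * (1 - t ^ (n : ℕ)))) := by
  have hd := summable_qPoch_double hz ht
  have hlog : ∀ j : ℕ, Complex.log (1 - z * t ^ j) =
      -∑' n : ℕ+, (z * t ^ j) ^ (n : ℕ) / (n : ℕ) := fun j => by
    rw [(hasSum_pnat_log (norm_mul_pow_lt_one hz ht j)).tsum_eq, neg_neg]
  have hne : ∀ j : ℕ, 1 - z * t ^ j ≠ 0 := fun j h => by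
    have h1 := norm_mul_pow_lt_one hz ht j
    rw [← sub_eq_zero.1 h, norm_one] at h1
    exact lt_irrefl _ h1
  have hs : Summable fun j : ℕ => Complex.log (1 - z * t ^ j) := by
    simp only [hlog]
    exact hd.prod.neg
  rw [qPoch, ← Complex.cexp_tsum_eq_tprod hne hs]
  simp only [hlog, tsum_neg]
  rw [show (∑' (j : ℕ) (n : ℕ+), (z * t ^ j) ^ (n : ℕ) / ((n : ℕ) : ℂ)) =
    ∑' (n : ℕ+) (j : ℕ), (z * t ^ j) ^ (n : ℕ) / ((n : ℕ) : ℂ) from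
      Summable.tsum_comm (f := fun (n : ℕ+) (j : ℕ) => (z * t ^ j) ^ (n : ℕ) / ((n : ℕ) : ℂ))
        hd.prod_symm]
  simp only [(hasSum_qPoch_inner z ht _).tsum_eq]

lemma qPoch_ne_zero {z t : ℂ} (hz : ‖z‖ < 1) (ht : ‖t‖ < 1) : qPoch z t ≠ 0 := by
  rw [qPoch_eq_exp hz ht]
  exact Complex.exp_ne_zero _

/-! ### Powers of `q` -/

lemma qpow_add (P : Params) (x y : ℂ) : qpow P (x + y) = qpow P x * qpow P y := by
  rw [qpow, qpow, qpow, add_mul, Complex.exp_add]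

@[simp] lemma qpow_zero (P : Params) : qpow P 0 = 1 := by simp [qpow]

lemma qpow_neg (P : Params) (x : ℂ) : qpow P (-x) = (qpow P x)⁻¹ := by
  rw [qpow, qpow, neg_mul, Complex.exp_neg]

lemma qpow_sub (P : Params) (x y : ℂ) : qpow P (x - y) = qpow P x / qpow P y := by
  rw [sub_eq_add_neg, qpow_add, qpow_neg, div_eq_mul_inv]

lemma qpow_ne_zero (P : Params) (x : ℂ) : qpow P x ≠ 0 := Complex.exp_ne_zero _

lemma qpow_mul_natCast (P : Params) (x : ℂ) (n : ℕ) : qpow P (x * n) = qpow P x ^ n := by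
  rw [qpow, qpow, ← Complex.exp_nat_mul]
  congr 1
  ring

lemma differentiable_qpow (P : Params) : Differentiable ℂ (qpow P) := by
  unfold qpow
  fun_prop

lemma norm_qpow_ofReal (P : Params) (x : ℝ) : ‖qpow P x‖ = Real.exp (x * P.logq.re) := by
  rw [qpow, Complex.norm_exp, Complex.re_ofReal_mul]

lemma norm_qpow_lt_one {P : Params} (hq : P.logq.re < 0) {x : ℝ} (hx : 0 < x) :
    ‖qpow P x‖ < 1 := by
  rw [norm_qpow_ofReal, Real.exp_lt_one_iff]
  exact mul_neg_of_pos_of_neg hx hq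

lemma qpow_sub_qpow_neg_ne_zero {P : Params} (hq : P.logq.re < 0) {x : ℝ} (hx : x ≠ 0) :
    qpow P x - qpow P (-x) ≠ 0 := by
  intro h
  have h1 := congrArg norm (sub_eq_zero.1 h)
  rw [show (-(x : ℂ)) = ((-x : ℝ) : ℂ) by push_cast; rfl, norm_qpow_ofReal, norm_qpow_ofReal,
    Real.exp_eq_exp] at h1
  have : x * P.logq.re = 0 := by linarith
  exact (mul_ne_zero hx hq.ne) this

lemma qnum_ne_zero {P : Params} (hq : P.logq.re < 0) {x : ℝ} (hx : x ≠ 0) : qnum P x ≠ 0 := by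
  refine div_ne_zero (qpow_sub_qpow_neg_ne_zero hq hx) ?_
  have := qpow_sub_qpow_neg_ne_zero hq one_ne_zero
  rwa [Complex.ofReal_one] at this

/-! ### The theta function -/

/-- Splitting the first factor off two of the products reduces the claim to 1 - z⁻¹ = -z⁻¹(1 - z).
-/
lemma Theta_inv {t z : ℂ} (ht : ‖t‖ < 1) (hz : z ≠ 0) : Theta t z⁻¹ = -z⁻¹ * Theta t z := by
  rw [Theta, Theta, inv_inv, qPoch_eq_mul z⁻¹ ht, qPoch_eq_mul z ht]
  field_simp
  ring

lemma theta_neg {P : Params} (hq : P.logq.re < 0) {ν : ℝ} (hν : 0 < ν) (u : ℂ) :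
    theta P ν (-u) = -theta P ν u := by
  have ht : ‖qpow P (2 * ν)‖ < 1 := by
    have := norm_qpow_lt_one hq (x := 2 * ν) (by positivity)
    rwa [Complex.ofReal_mul, Complex.ofReal_ofNat] at this
  rw [theta, theta, mul_neg, qpow_neg, Theta_inv ht (qpow_ne_zero _ _),
    show (-u) ^ 2 / (ν : ℂ) - -u = (u ^ 2 / ν - u) + 2 * u by ring, qpow_add]
  have := qpow_ne_zero P (2 * u)
  generalize qpow P (2 * u) = y at *
  field_simp

end EllipticSl2

/-! ### Product form of the theta function, and growth estimates. -/

namespace EllipticSl2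

open Filter Topology

lemma norm_qpow_two_lt_one {P : Params} (hq : P.logq.re < 0) {ν : ℝ} (hν : 0 < ν) :
    ‖qpow P (2 * ν)‖ < 1 := by
  have := norm_qpow_lt_one hq (x := 2 * ν) (by positivity)
  rwa [Complex.ofReal_mul, Complex.ofReal_ofNat] at this

/-- Both products are written with arguments that are powers of q, the form in which contractions
produce them; the constant in front cancels in quotients. -/
lemma theta_eq (P : Params) (ν : ℝ) (u : ℂ) :
    theta P ν u = qPoch (qpow P (2 * ν)) (qpow P (2 * ν)) /
        qPoch (qpow P (2 * ν)) (qpow P (2 * ν)) ^ 3 *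
      (qpow P (u ^ 2 / ν - u) * (qPoch (qpow P (2 * u)) (qpow P (2 * ν)) *
        qPoch (qpow P (2 * ν - 2 * u)) (qpow P (2 * ν)))) := by
  rw [theta, Theta, qpow_sub P (2 * ν) (2 * u), div_eq_mul_inv (qpow P (2 * ν))]
  ring

lemma exists_theta_ne_zero {P : Params} (hq : P.logq.re < 0) {ν : ℝ} (hν : 0 < ν) :
    ∃ u, theta P ν u ≠ 0 := by
  -- At u = ν/2 both products have argument q^ν, which lies in the unit disc.
  refine ⟨ν / 2, ?_⟩
  have ht := norm_qpow_two_lt_one hq hν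
  have h1 := norm_qpow_lt_one hq hν
  rw [theta_eq, show 2 * ((ν : ℂ) / 2) = ν by ring, show 2 * (ν : ℂ) - ν = ν by ring]
  have h2 := qPoch_ne_zero ht ht
  have h3 := qPoch_ne_zero h1 ht
  exact mul_ne_zero (div_ne_zero h2 (pow_ne_zero _ h2))
    (mul_ne_zero (qpow_ne_zero _ _) (mul_ne_zero h3 h3))

/-! ### Geometrically bounded sequences -/

/-- Sequences of at most geometric growth. -/
def GeomBounded (f : ℕ+ → ℂ) : Prop :=
  ∃ C R : ℝ, 0 ≤ C ∧ 0 ≤ R ∧ ∀ n, ‖f n‖ ≤ C * R ^ (n : ℕ)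

namespace GeomBounded

variable {f g : ℕ+ → ℂ}

lemma of_bounded {C : ℝ} (h : ∀ n, ‖f n‖ ≤ C) : GeomBounded f :=
  ⟨C, 1, (norm_nonneg _).trans (h 1), zero_le_one, fun n => by simpa using h n⟩

lemma const (c : ℂ) : GeomBounded fun _ => c := of_bounded fun _ => le_rfl

lemma pow (c : ℂ) : GeomBounded fun n => c ^ (n : ℕ) :=
  ⟨1, ‖c‖, zero_le_one, norm_nonneg _, fun n => by simp⟩

lemma neg (hf : GeomBounded f) : GeomBounded fun n => -f n := by
  simpa only [GeomBounded, norm_neg] using hf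

lemma add (hf : GeomBounded f) (hg : GeomBounded g) : GeomBounded fun n => f n + g n := by
  obtain ⟨C, R, hC, hR, h⟩ := hf
  obtain ⟨C', R', hC', hR', h'⟩ := hg
  refine ⟨C + C', max R R', by positivity, by positivity, fun n => (norm_add_le _ _).trans ?_⟩
  rw [add_mul]
  refine add_le_add ((h n).trans ?_) ((h' n).trans ?_)
  · gcongr
    exact le_max_left _ _
  · gcongr
    exact le_max_right _ _

lemma sub (hf : GeomBounded f) (hg : GeomBounded g) : GeomBounded fun n => f n - g n := by
  simpa only [sub_eq_add_neg] using hf.add hg.neg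

lemma mul (hf : GeomBounded f) (hg : GeomBounded g) : GeomBounded fun n => f n * g n := by
  obtain ⟨C, R, hC, hR, h⟩ := hf
  obtain ⟨C', R', hC', hR', h'⟩ := hg
  refine ⟨C * C', R * R', by positivity, by positivity, fun n => ?_⟩
  rw [norm_mul, mul_pow, mul_mul_mul_comm]
  exact mul_le_mul (h n) (h' n) (norm_nonneg _) (by positivity)

lemma div (hf : GeomBounded f) (hg : GeomBounded fun n => (g n)⁻¹) :
    GeomBounded fun n => f n / g n := by
  simpa only [div_eq_mul_inv] using hf.mul hg

lemma qpow_mul (P : Params) (x : ℂ) : GeomBounded fun n => qpow P (x * (n : ℕ)) := by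
  simpa only [qpow_mul_natCast] using pow (qpow P x)

lemma qnum_mul (P : Params) (x : ℂ) : GeomBounded fun n => qnum P (x * (n : ℕ)) := by
  have := ((qpow_mul P x).sub (qpow_mul P (-x))).div (const (qpow P 1 - qpow P (-1))⁻¹)
  simpa only [qnum, neg_mul] using this

/-- One of |q^(xn)|, |q^(-xn)| is at least e^|x Re log q| and the other at most 1. The numerator of
[xn] is therefore bounded away from 0 uniformly in n. -/
lemma qnum_mul_inv {P : Params} (hq : P.logq.re < 0) {x : ℝ} (hx : x ≠ 0) :
    GeomBounded fun n => (qnum P (x * (n : ℕ)))⁻¹ := by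
  have key : ∀ n : ℕ+, Real.exp (|x * P.logq.re|) - 1 ≤
      ‖qpow P (x * (n : ℕ)) - qpow P (-(x * (n : ℕ)))‖ := by
    intro n
    have hn : (1 : ℝ) ≤ (n : ℕ) := by exact_mod_cast n.pos
    set a := x * P.logq.re with ha
    have h1 : ‖qpow P (x * (n : ℕ))‖ = Real.exp ((n : ℕ) * a) := by
      rw [show (x : ℂ) * (n : ℕ) = ((x * (n : ℕ) : ℝ) : ℂ) by push_cast; rfl, norm_qpow_ofReal]
      congr 1
      rw [ha]; ring
    have h2 : ‖qpow P (-(x * (n : ℕ)))‖ = Real.exp (-((n : ℕ) * a)) := by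
      rw [qpow_neg, norm_inv, h1, Real.exp_neg]
    rcases le_total 0 a with h0 | h0
    · refine le_trans ?_ (norm_sub_norm_le _ _)
      rw [h1, h2, abs_of_nonneg h0]
      have h3 : Real.exp a ≤ Real.exp ((n : ℕ) * a) :=
        Real.exp_le_exp.2 (le_mul_of_one_le_left h0 hn)
      have h4 : Real.exp (-((n : ℕ) * a)) ≤ 1 := Real.exp_le_one_iff.2 (by nlinarith)
      linarith
    · rw [norm_sub_rev]
      refine le_trans ?_ (norm_sub_norm_le _ _)
      rw [h1, h2, abs_of_nonpos h0]
      have h3 : Real.exp (-a) ≤ Real.exp (-((n : ℕ) * a)) :=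
        Real.exp_le_exp.2 (by nlinarith)
      have h4 : Real.exp ((n : ℕ) * a) ≤ 1 := Real.exp_le_one_iff.2 (by nlinarith)
      linarith
  have hpos : 0 < Real.exp (|x * P.logq.re|) - 1 := by
    have : 0 < |x * P.logq.re| := abs_pos.2 (mul_ne_zero hx hq.ne)
    have := Real.add_one_lt_exp this.ne'
    linarith
  have h : GeomBounded fun n => (qpow P (x * (n : ℕ)) - qpow P (-(x * (n : ℕ))))⁻¹ := by
    refine of_bounded (C := (Real.exp (|x * P.logq.re|) - 1)⁻¹) fun n => ?_
    rw [norm_inv]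
    exact inv_anti₀ hpos (key n)
  simpa only [qnum, inv_div, div_eq_mul_inv, mul_inv, inv_inv, mul_comm] using
    h.mul (const (qpow P 1 - qpow P (-1)))

lemma natCast_inv : GeomBounded fun n => ((n : ℕ) : ℂ)⁻¹ :=
  of_bounded (C := 1) fun n => by
    rw [norm_inv, Complex.norm_natCast]
    exact inv_le_one_of_one_le₀ (by exact_mod_cast n.pos)

lemma summable (hf : GeomBounded f) :
    ∃ ρ : ℝ, 0 < ρ ∧ ∀ y : ℂ, ‖y‖ < ρ → Summable fun n => ‖f n * y ^ (n : ℕ)‖ := by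
  obtain ⟨C, R, hC, hR, h⟩ := hf
  refine ⟨(R + 1)⁻¹, by positivity, fun y hy => ?_⟩
  have h1 : R * ‖y‖ < 1 := by
    have h2 : R * ‖y‖ ≤ R * (R + 1)⁻¹ := mul_le_mul_of_nonneg_left hy.le hR
    have h3 : R * (R + 1)⁻¹ < 1 := by
      rw [← div_eq_mul_inv, div_lt_one (by positivity)]
      exact lt_add_one R
    exact h2.trans_lt h3
  refine Summable.of_nonneg_of_le (fun n => norm_nonneg _) (fun n => ?_)
    ((summable_pnat_pow (by positivity) h1).mul_left C)
  rw [norm_mul, norm_pow, mul_pow, ← mul_assoc]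
  exact mul_le_mul_of_nonneg_right (h n) (by positivity)

end GeomBounded

lemma geomBounded_oscComm (P : Params) (x : Boson) : GeomBounded fun n => oscComm P (x, n) := by
  have h1 : GeomBounded fun n => qnum P ((n : ℕ) : ℂ) := by
    simpa only [one_mul] using GeomBounded.qnum_mul P 1
  have h2 := (h1.mul h1).mul GeomBounded.natCast_inv
  cases x
  · exact ((GeomBounded.qnum_mul P (P.k + 2)).mul (GeomBounded.qnum_mul P 2)).mul
      GeomBounded.natCast_inv
  · simpa only [oscComm, sq, div_eq_mul_inv] using h2.neg
  · simpa only [oscComm, sq, div_eq_mul_inv] using h2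

end EllipticSl2

namespace EllipticSl2

open Filter Topology

instance : Fintype Boson := ⟨{.a, .b, .c}, fun x => by cases x <;> simp⟩

/-! ### Boson fields of the variable `z = q ^ {2u}` -/

/-- A linear combination of the generators which depends on `z = q^{2u}` like a boson field: the
coefficient of `x_n` is a multiple of `z^{-n}` of at most geometric growth in `n`, the coefficients
of the modes `q` are constant and those of `p` and `1` are entire in `u`. -/
structure IsBosonField (P : Params) (A : ℂ → Boselin) : Prop where
  ann : ∀ x n u, A u (.ann (x, n)) = A 0 (.ann (x, n)) * qpow P (-(2 * u)) ^ (n : ℕ)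
  cre : ∀ x n u, A u (.cre (x, n)) = A 0 (.cre (x, n)) * qpow P (2 * u) ^ (n : ℕ)
  q : ∀ x u, A u (.q x) = A 0 (.q x)
  p : ∀ x, Differentiable ℂ fun u => A u (.p x)
  one : Differentiable ℂ fun u => A u .one
  ann_bdd : ∀ x, GeomBounded fun n => A 0 (.ann (x, n))
  cre_bdd : ∀ x, GeomBounded fun n => A 0 (.cre (x, n))

namespace IsBosonField

variable {P : Params} {A B : ℂ → Boselin}

lemma differentiable (hA : IsBosonField P A) (g : Gen) : Differentiable ℂ fun u => A u g := by
  have hq : Differentiable ℂ (qpow P) := differentiable_qpow P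
  cases g with
  | ann i =>
    obtain ⟨x, n⟩ := i
    rw [funext (hA.ann x n)]
    fun_prop
  | cre i =>
    obtain ⟨x, n⟩ := i
    rw [funext (hA.cre x n)]
    fun_prop
  | q x =>
    rw [funext (hA.q x)]
    fun_prop
  | p x => exact hA.p x
  | one => exact hA.one

lemma neg (hA : IsBosonField P A) : IsBosonField P fun u => -A u where
  ann x n u := by simp only [Pi.neg_apply, hA.ann x n u, neg_mul]
  cre x n u := by simp only [Pi.neg_apply, hA.cre x n u, neg_mul]
  q x u := by simp only [Pi.neg_apply, hA.q x u]
  p x := (hA.p x).neg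
  one := hA.one.neg
  ann_bdd x := (hA.ann_bdd x).neg
  cre_bdd x := (hA.cre_bdd x).neg

lemma add (hA : IsBosonField P A) (hB : IsBosonField P B) :
    IsBosonField P fun u => A u + B u where
  ann x n u := by simp only [Pi.add_apply, hA.ann x n u, hB.ann x n u, add_mul]
  cre x n u := by simp only [Pi.add_apply, hA.cre x n u, hB.cre x n u, add_mul]
  q x u := by simp only [Pi.add_apply, hA.q x u, hB.q x u]
  p x := (hA.p x).add (hB.p x)
  one := hA.one.add hB.one
  ann_bdd x := (hA.ann_bdd x).add (hB.ann_bdd x)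
  cre_bdd x := (hA.cre_bdd x).add (hB.cre_bdd x)

lemma sub (hA : IsBosonField P A) (hB : IsBosonField P B) :
    IsBosonField P fun u => A u - B u := by
  simpa only [sub_eq_add_neg] using hA.add hB.neg

lemma const_smul (c : ℂ) (hA : IsBosonField P A) : IsBosonField P fun u => c • A u where
  ann x n u := by simp only [Pi.smul_apply, hA.ann x n u, smul_mul_assoc]
  cre x n u := by simp only [Pi.smul_apply, hA.cre x n u, smul_mul_assoc]
  q x u := by simp only [Pi.smul_apply, hA.q x u]
  p x := (hA.p x).const_smul c
  one := hA.one.const_smul c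
  ann_bdd x := (GeomBounded.const c).mul (hA.ann_bdd x)
  cre_bdd x := (GeomBounded.const c).mul (hA.cre_bdd x)

lemma annSum (x : Boson) {f : ℂ → ℕ → ℂ} {g : ℕ → ℂ} (hg : GeomBounded fun n => g n) {s : ℂ → ℂ}
    (hs : ∀ u, s u = 2 * u + s 0) (hf : ∀ u n, f u n = g n * qpow P (-(s u * n))) :
    IsBosonField P fun u => annSum x (f u) where
  ann y n u := by
    simp only [EllipticSl2.annSum, hf]
    split_ifs
    · rw [hs u, mul_assoc, ← qpow_mul_natCast, ← qpow_add]
      congr 2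
      ring
    · rw [zero_mul]
  cre y n u := by simp only [EllipticSl2.annSum, zero_mul]
  q y u := rfl
  p y := differentiable_const _
  one := differentiable_const _
  ann_bdd y := by
    simp only [EllipticSl2.annSum, hf, ← neg_mul]
    split_ifs
    · exact hg.mul (GeomBounded.qpow_mul P _)
    · exact GeomBounded.const 0
  cre_bdd y := GeomBounded.const 0

lemma creSum (x : Boson) {f : ℂ → ℕ → ℂ} {g : ℕ → ℂ} (hg : GeomBounded fun n => g n) {s : ℂ → ℂ}
    (hs : ∀ u, s u = 2 * u + s 0) (hf : ∀ u n, f u n = g n * qpow P (s u * n)) :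
    IsBosonField P fun u => creSum x (f u) where
  ann y n u := by simp only [EllipticSl2.creSum, zero_mul]
  cre y n u := by
    simp only [EllipticSl2.creSum, hf]
    split_ifs
    · rw [hs u, mul_assoc, ← qpow_mul_natCast, ← qpow_add]
      congr 2
      ring
    · rw [zero_mul]
  q y u := rfl
  p y := differentiable_const _
  one := differentiable_const _
  ann_bdd y := GeomBounded.const 0
  cre_bdd y := by
    simp only [EllipticSl2.creSum, hf]
    split_ifs
    · exact hg.mul (GeomBounded.qpow_mul P _)
    · exact GeomBounded.const 0

lemma qZ (x : ZeroMode) : IsBosonField P fun _ => qZ x where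
  ann y n u := by simp only [EllipticSl2.qZ, zero_mul]
  cre y n u := by simp only [EllipticSl2.qZ, zero_mul]
  q y u := rfl
  p y := differentiable_const _
  one := differentiable_const _
  ann_bdd y := GeomBounded.const 0
  cre_bdd y := GeomBounded.const 0

lemma smul_of_momentum {X : Boselin} (ha : ∀ i, X (.ann i) = 0) (hc : ∀ i, X (.cre i) = 0)
    (hX : ∀ x, X (.q x) = 0) {f : ℂ → ℂ} (hf : Differentiable ℂ f) :
    IsBosonField P fun u => f u • X where
  ann y n u := by simp [ha]
  cre y n u := by simp [hc]
  q y u := by simp [hX]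
  p y := hf.smul_const _
  one := hf.smul_const _
  ann_bdd y := by simpa [ha] using GeomBounded.const 0
  cre_bdd y := by simpa [hc] using GeomBounded.const 0

/-! ### Contractions of boson fields -/

/-- The powers of z and w in the nth contraction combine into (w/z)^n, so contractions need only be
computed at u = v = 0. -/
lemma oscContr_eq (hA : IsBosonField P A) (hB : IsBosonField P B) (u v : ℂ) (x : Boson) (n : ℕ+) :
    oscContr P (A u) (B v) (x, n) =
      oscContr P (A 0) (B 0) (x, n) * (qpow P (2 * v) / qpow P (2 * u)) ^ (n : ℕ) := by
  rw [oscContr, hA.ann, hB.cre, qpow_neg, div_eq_mul_inv, mul_pow, oscContr]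
  ring

lemma geomBounded_oscContr (hA : IsBosonField P A) (hB : IsBosonField P B) (x : Boson) :
    GeomBounded fun n => oscContr P (A 0) (B 0) (x, n) :=
  ((hA.ann_bdd x).mul (geomBounded_oscComm P x)).mul (hB.cre_bdd x)

lemma exists_summable_oscContr (hA : IsBosonField P A) (hB : IsBosonField P B) :
    ∃ ρ : ℝ, 0 < ρ ∧ ∀ u v : ℂ, ‖qpow P (2 * v) / qpow P (2 * u)‖ < ρ →
      Summable fun m => ‖oscContr P (A u) (B v) m‖ := by
  choose ρ hρ h using fun x => (hA.geomBounded_oscContr hB x).summable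
  refine ⟨min (ρ .a) (min (ρ .b) (ρ .c)), lt_min (hρ _) (lt_min (hρ _) (hρ _)),
    fun u v huv => ?_⟩
  have hx : ∀ x, ‖qpow P (2 * v) / qpow P (2 * u)‖ < ρ x := by
    rw [lt_min_iff, lt_min_iff] at huv
    intro x
    cases x
    exacts [huv.1, huv.2.1, huv.2.2]
  rw [summable_prod_of_nonneg fun _ => norm_nonneg _]
  refine ⟨fun x => ?_, (hasSum_fintype _).summable⟩
  simp only [hA.oscContr_eq hB u v]
  exact h x _ (hx x)

lemma tsum_oscContr (hA : IsBosonField P A) (hB : IsBosonField P B) {u v : ℂ}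
    (h : Summable fun m => ‖oscContr P (A u) (B v) m‖) :
    ∑' m, oscContr P (A u) (B v) m = ∑' n : ℕ+, (∑ x, oscContr P (A 0) (B 0) (x, n)) *
      (qpow P (2 * v) / qpow P (2 * u)) ^ (n : ℕ) := by
  have hs : Summable fun m => oscContr P (A u) (B v) m := h.of_norm
  rw [hs.tsum_prod, tsum_fintype, ← Summable.tsum_finsetSum fun x _ => hs.prod_factor x]
  refine tsum_congr fun n => ?_
  rw [Finset.sum_mul]
  exact Finset.sum_congr rfl fun x _ => hA.oscContr_eq hB u v x n

/-! ### Dependence of matrix elements on the parameters -/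

lemma differentiable_zeroContr_fst (hA : IsBosonField P A) (hB : IsBosonField P B) :
    Differentiable ℂ fun w : ℂ × ℂ => zeroContr P (A w.1) (B w.2) := by
  have h1 := fun g => (hA.differentiable g).comp (differentiable_fst (𝕜 := ℂ) (E := ℂ) (F := ℂ))
  have h2 := fun g => (hB.differentiable g).comp (differentiable_snd (𝕜 := ℂ) (E := ℂ) (F := ℂ))
  simp only [Function.comp_def] at h1 h2
  have h := fun x => (h1 (.p x)).mul ((h2 (.q x)).const_mul (zeroComm P x))
  exact (((h .a).add (h .b)).add (h .c)).add (h .hat)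

lemma differentiable_zeroContr_snd (hA : IsBosonField P A) (hB : IsBosonField P B) :
    Differentiable ℂ fun w : ℂ × ℂ => zeroContr P (B w.2) (A w.1) := by
  have h1 := fun g => (hA.differentiable g).comp (differentiable_fst (𝕜 := ℂ) (E := ℂ) (F := ℂ))
  have h2 := fun g => (hB.differentiable g).comp (differentiable_snd (𝕜 := ℂ) (E := ℂ) (F := ℂ))
  simp only [Function.comp_def] at h1 h2
  have h := fun x => (h2 (.p x)).mul ((h1 (.q x)).const_mul (zeroComm P x))
  exact (((h .a).add (h .b)).add (h .c)).add (h .hat)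

end IsBosonField

section Entire

variable {E : Type*} [NormedAddCommGroup E] [NormedSpace ℂ E]

lemma differentiable_dpow {ι : Type*} {f : E → ι → ℂ}
    (hf : ∀ i, Differentiable ℂ fun w => f w i) (e : ι →₀ ℕ) :
    Differentiable ℂ fun w => dpow (f w) e := by
  classical
  simp only [dpow, Finsupp.prod, smul_eq_mul]
  have h : ∀ i, Differentiable ℂ fun w => ((e i).factorial : ℂ)⁻¹ * f w i ^ e i := fun i => by
    fun_prop
  exact fun w => (HasFDerivAt.finsetProd fun i _ => (h i w).hasFDerivAt).differentiableAt

/-- A fixed matrix element is a finite sum of products of divided powers, hence a polynomial in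
finitely many coefficients of X. -/
lemma differentiable_oscMatrix (P : Params) {X : E → Boselin}
    (hX : ∀ g, Differentiable ℂ fun w => X w g) (i j : Occ) :
    Differentiable ℂ fun w => oscMatrix P (X w) i j := by
  classical
  have h1 : ∀ e : Occ, Differentiable ℂ fun w => dpow (fun m => X w (.cre m)) e := fun e =>
    differentiable_dpow (fun m => hX _) e
  have h2 : ∀ e : Occ, Differentiable ℂ fun w => dpow (fun m => X w (.ann m) * oscComm P m) e :=
    fun e => differentiable_dpow (fun m => (hX _).mul_const _) e
  have h3 : ∀ c : Occ, Differentiable ℂ fun w => MvPolynomial.coeff c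
      (translate (fun m => X w (.ann m) * oscComm P m) (MvPolynomial.monomial j 1)) := by
    intro c
    have : ∀ w, MvPolynomial.coeff c
        (translate (fun m => X w (.ann m) * oscComm P m) (MvPolynomial.monomial j 1)) =
        (invFact j)⁻¹ * if c ≤ j then
          invFact c * dpow (fun m => X w (.ann m) * oscComm P m) (j - c) else 0 := fun w => by
      rw [← coeff_translate_monomial, inv_mul_cancel_left₀ (invFact_ne_zero j)]
    simp only [this]
    split_ifs
    · exact ((h2 _).const_mul _).const_mul _
    · exact differentiable_const _
  simp only [oscMatrix, MvPowerSeries.coeff_mul, coeff_creExp, MvPolynomial.coeff_coe]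
  exact Differentiable.fun_sum fun p _ => (h1 p.1).mul (h3 p.2)

/-- Since the coefficients of the modes q are constant, the weight shift, and with it the case
distinction in `nexp`, does not depend on the parameter. -/
lemma differentiable_nexp (P : Params) {X : E → Boselin}
    (hX : ∀ g, Differentiable ℂ fun w => X w g) (hq : ∀ x w w', X w (.q x) = X w' (.q x))
    (i j : Idx) : Differentiable ℂ fun w => nexp P (X w) i j := by
  classical
  simp only [nexp_apply]
  by_cases h : i.1 = fun x => j.1 x + X 0 (.q x)
  · have h' : ∀ w, i.1 = fun x => j.1 x + X w (.q x) := fun w => by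
      simpa only [hq _ w 0] using h
    simp only [if_pos (h' _)]
    have := differentiable_oscMatrix P hX i.2 j.2
    unfold zeroExponent
    fun_prop
  · have h' : ∀ w, ¬ i.1 = fun x => j.1 x + X w (.q x) := fun w => by
      simpa only [hq _ w 0] using h
    simp only [if_neg (h' _)]
    fun_prop

end Entire

lemma exists_qpow_eq {P : Params} (hq : P.logq.re < 0) {y : ℂ} (hy : y ≠ 0) :
    ∃ v, qpow P (2 * v) = y := by
  have h0 : P.logq ≠ 0 := by
    rintro h
    simp [h] at hq
  refine ⟨Complex.log y / (2 * P.logq), ?_⟩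
  rw [qpow, ← Complex.exp_log hy]
  congr 1
  rw [Complex.exp_log hy]
  field_simp

/-- The exchange relation of two normal ordered exponentials, given closed forms `G₁ / G₂` of their
contractions. -/
lemma exchangeRel_nexp {P : Params} (hq : P.logq.re < 0) {A B : ℂ → Boselin}
    (hA : IsBosonField P A) (hB : IsBosonField P B) {G₁ G₂ G₁' G₂' : ℂ → ℂ}
    (hG₁ : Differentiable ℂ G₁) (hG₂ : Differentiable ℂ G₂)
    (hG₁' : Differentiable ℂ G₁') (hG₂' : Differentiable ℂ G₂')
    (hne : ∃ y, y ≠ 0 ∧ G₂ y ≠ 0) (hne' : ∃ y, y ≠ 0 ∧ G₂' y ≠ 0)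
    (hc : ∃ ρ : ℝ, 0 < ρ ∧ ∀ y : ℂ, ‖y‖ < ρ → G₂ y * Complex.exp
      (∑' n : ℕ+, (∑ x, oscContr P (A 0) (B 0) (x, n)) * y ^ (n : ℕ)) = G₁ y)
    (hc' : ∃ ρ : ℝ, 0 < ρ ∧ ∀ y : ℂ, ‖y‖ < ρ → G₂' y * Complex.exp
      (∑' n : ℕ+, (∑ x, oscContr P (B 0) (A 0) (x, n)) * y ^ (n : ℕ)) = G₁' y)
    {num den : ℂ → ℂ → ℂ} (hden : ∃ u v, den u v ≠ 0)
    (hrel : ∀ u v, den u v * (G₁ (qpow P (2 * v) / qpow P (2 * u)) *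
        Complex.exp (zeroContr P (A u) (B v)) * G₂' (qpow P (2 * u) / qpow P (2 * v))) =
      num u v * (G₁' (qpow P (2 * u) / qpow P (2 * v)) *
        Complex.exp (zeroContr P (B v) (A u)) * G₂ (qpow P (2 * v) / qpow P (2 * u)))) :
    ExchangeRel P (fun u => nexp P (A u)) (fun v => nexp P (B v)) num den := by
  obtain ⟨ρ₁, hρ₁, h₁⟩ := hc
  obtain ⟨ρ₂, hρ₂, h₂⟩ := hc'
  obtain ⟨ρ₃, hρ₃, h₃⟩ := hA.exists_summable_oscContr hB
  obtain ⟨ρ₄, hρ₄, h₄⟩ := hB.exists_summable_oscContr hA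
  have hdiv : Differentiable ℂ fun w : ℂ × ℂ => qpow P (2 * w.2) / qpow P (2 * w.1) := by
    have := differentiable_qpow P
    simp only [← qpow_sub]
    fun_prop
  have hdiv' : Differentiable ℂ fun w : ℂ × ℂ => qpow P (2 * w.1) / qpow P (2 * w.2) := by
    have := differentiable_qpow P
    simp only [← qpow_sub]
    fun_prop
  refine ⟨min (min ρ₁ ρ₂) (min ρ₃ ρ₄), lt_min (lt_min hρ₁ hρ₂) (lt_min hρ₃ hρ₄), fun i j => ?_⟩
  have hN : Differentiable ℂ fun w : ℂ × ℂ => nexp P (A w.1 + B w.2) i j := by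
    refine differentiable_nexp P (fun g => ?_) (fun x w w' => ?_) i j
    · exact ((hA.differentiable g).comp differentiable_fst).add
        ((hB.differentiable g).comp differentiable_snd)
    · rw [Pi.add_apply, Pi.add_apply, hA.q x w.1, hB.q x w.2, hA.q x w'.1, hB.q x w'.2]
  -- The factor of :exp(A+B): is common to both numerators and entire. The denominators are the
  -- denominators of the continued oscillator contractions.
  refine ⟨fun w => G₁ (qpow P (2 * w.2) / qpow P (2 * w.1)) *
      Complex.exp (zeroContr P (A w.1) (B w.2)) * nexp P (A w.1 + B w.2) i j,
    fun w => G₂ (qpow P (2 * w.2) / qpow P (2 * w.1)),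
    fun w => G₁' (qpow P (2 * w.1) / qpow P (2 * w.2)) *
      Complex.exp (zeroContr P (B w.2) (A w.1)) * nexp P (A w.1 + B w.2) i j,
    fun w => G₂' (qpow P (2 * w.1) / qpow P (2 * w.2)),
    ((hG₁.comp hdiv).mul (hA.differentiable_zeroContr_fst hB).cexp).mul hN, hG₂.comp hdiv,
    ((hG₁'.comp hdiv').mul (hA.differentiable_zeroContr_snd hB).cexp).mul hN, hG₂'.comp hdiv',
    ?_, ?_, fun u v huv => ?_, fun u v huv => ?_, hden, fun u v => ?_⟩
  · obtain ⟨y, hy, h⟩ := hne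
    obtain ⟨v, rfl⟩ := exists_qpow_eq hq hy
    intro h0
    apply h
    have := congrFun h0 (0, v)
    simpa using this
  · obtain ⟨y, hy, h⟩ := hne'
    obtain ⟨v, rfl⟩ := exists_qpow_eq hq hy
    intro h0
    apply h
    have := congrFun h0 (v, 0)
    simpa using this
  · simp only [lt_min_iff] at huv
    have hs := h₃ u v huv.2.1
    have := hasSum_nexp_mul_nexp hs i j
    refine ⟨this.summable, ?_⟩
    rw [this.tsum_eq, hA.tsum_oscContr hB hs, ← mul_assoc, ← mul_assoc, h₁ _ huv.1.1]
  · simp only [lt_min_iff] at huv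
    have hs := h₄ v u huv.2.2
    have := hasSum_nexp_mul_nexp hs i j
    refine ⟨this.summable, ?_⟩
    rw [this.tsum_eq, hB.tsum_oscContr hA hs, ← mul_assoc, ← mul_assoc, h₂ _ huv.1.2,
      add_comm (B v)]
  · linear_combination nexp P (A u + B v) i j * hrel u v

/-! ### Linear combinations of exchange relations -/

/-- Restrict to the complex line through a point where D is nonzero and one where D' is nonzero. The
one-variable identity theorem applies there. -/
lemma mul_ne_zero_of_differentiable {D D' : ℂ × ℂ → ℂ} (hD : Differentiable ℂ D)
    (hD' : Differentiable ℂ D') (h : D ≠ 0) (h' : D' ≠ 0) : D * D' ≠ 0 := by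
  obtain ⟨a, ha⟩ := Function.ne_iff.1 h
  obtain ⟨b, hb⟩ := Function.ne_iff.1 h'
  have hl : Differentiable ℂ fun t : ℂ => a + t • (b - a) := by fun_prop
  have hf := (hD.comp hl)
  have hg := (hD'.comp hl)
  intro h0
  have h1 : ∀ᶠ t in 𝓝 (0 : ℂ), D (a + t • (b - a)) ≠ 0 := by
    refine hf.continuous.continuousAt.eventually_ne ?_
    simpa using ha
  have h2 : ∀ᶠ t in 𝓝 (0 : ℂ), D' (a + t • (b - a)) = 0 := by
    filter_upwards [h1] with t ht
    have := congrFun h0 (a + t • (b - a))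
    exact (mul_eq_zero.1 this).resolve_left ht
  have h3 := AnalyticOnNhd.eqOn_zero_of_preconnected_of_eventuallyEq_zero
    (f := fun t : ℂ => D' (a + t • (b - a))) (U := Set.univ) (z₀ := 0)
    (fun t _ => hg.analyticAt t) isPreconnected_univ (Set.mem_univ _) h2 (Set.mem_univ 1)
  apply hb
  simpa using h3

/-- Fractions are brought to a common denominator. This needs one exchange factor for both summands,
and a product of nonzero entire functions to be nonzero. -/
lemma ExchangeRel.sub {P : Params} {X X' Y : ℂ → Op} {num den : ℂ → ℂ → ℂ}
    (h : ExchangeRel P X Y num den) (h' : ExchangeRel P X' Y num den) :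
    ExchangeRel P (fun u => X u - X' u) Y num den := by
  obtain ⟨ρ, hρ, h⟩ := h
  obtain ⟨ρ', hρ', h'⟩ := h'
  refine ⟨min ρ ρ', lt_min hρ hρ', fun i j => ?_⟩
  obtain ⟨N₁, D₁, N₂, D₂, hN₁, hD₁, hN₂, hD₂, h₁, h₂, hs₁, hs₂, hden, hr⟩ := h i j
  obtain ⟨N₁', D₁', N₂', D₂', hN₁', hD₁', hN₂', hD₂', h₁', h₂', hs₁', hs₂', -, hr'⟩ := h' i j
  refine ⟨N₁ * D₁' - N₁' * D₁, D₁ * D₁', N₂ * D₂' - N₂' * D₂, D₂ * D₂',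
    (hN₁.mul hD₁').sub (hN₁'.mul hD₁), hD₁.mul hD₁', (hN₂.mul hD₂').sub (hN₂'.mul hD₂),
    hD₂.mul hD₂', mul_ne_zero_of_differentiable hD₁ hD₁' h₁ h₁',
    mul_ne_zero_of_differentiable hD₂ hD₂' h₂ h₂', fun u v huv => ?_, fun u v huv => ?_, hden,
    fun u v => ?_⟩
  · obtain ⟨hs, he⟩ := hs₁ u v (huv.trans_le (min_le_left _ _))
    obtain ⟨hs', he'⟩ := hs₁' u v (huv.trans_le (min_le_right _ _))
    simp only [Pi.sub_apply, Pi.mul_apply, sub_mul]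
    refine ⟨hs.sub hs', ?_⟩
    rw [hs.tsum_sub hs', ← he, ← he']
    ring
  · obtain ⟨hs, he⟩ := hs₂ u v (huv.trans_le (min_le_left _ _))
    obtain ⟨hs', he'⟩ := hs₂' u v (huv.trans_le (min_le_right _ _))
    simp only [Pi.sub_apply, Pi.mul_apply, mul_sub]
    refine ⟨hs.sub hs', ?_⟩
    rw [hs.tsum_sub hs', ← he, ← he']
    ring
  · simp only [Pi.sub_apply, Pi.mul_apply]
    linear_combination D₁' (u, v) * D₂' (u, v) * hr u v - D₁ (u, v) * D₂ (u, v) * hr' u v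

lemma ExchangeRel.smul {P : Params} {X Y : ℂ → Op} {num den : ℂ → ℂ → ℂ}
    (h : ExchangeRel P X Y num den) {c : ℂ → ℂ} (hc : Differentiable ℂ c) :
    ExchangeRel P (fun u => c u • X u) Y num den := by
  obtain ⟨ρ, hρ, h⟩ := h
  refine ⟨ρ, hρ, fun i j => ?_⟩
  obtain ⟨N₁, D₁, N₂, D₂, hN₁, hD₁, hN₂, hD₂, h₁, h₂, hs₁, hs₂, hden, hr⟩ := h i j
  have hc' : Differentiable ℂ fun w : ℂ × ℂ => c w.1 := hc.comp differentiable_fst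
  refine ⟨fun w => c w.1 * N₁ w, D₁, fun w => c w.1 * N₂ w, D₂, hc'.mul hN₁, hD₁, hc'.mul hN₂, hD₂,
    h₁, h₂, fun u v huv => ?_, fun u v huv => ?_, hden, fun u v => ?_⟩
  · obtain ⟨hs, he⟩ := hs₁ u v huv
    simp only [Pi.smul_apply, smul_eq_mul, mul_assoc]
    refine ⟨hs.mul_left _, ?_⟩
    rw [tsum_mul_left, ← he]
    ring
  · obtain ⟨hs, he⟩ := hs₂ u v huv
    simp only [Pi.smul_apply, smul_eq_mul, mul_left_comm _ (c u)]
    refine ⟨hs.mul_left _, ?_⟩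
    rw [tsum_mul_left, ← he]
    ring
  · linear_combination c u * hr u v

end EllipticSl2

namespace EllipticSl2

/-! ### Exchange relations from contractions -/

lemma exchangeRel_nexp_one {P : Params} (hq : P.logq.re < 0) {A B : ℂ → Boselin}
    (hA : IsBosonField P A) (hB : IsBosonField P B)
    (hAB : ∀ n, ∑ x, oscContr P (A 0) (B 0) (x, n) = 0)
    (hBA : ∀ n, ∑ x, oscContr P (B 0) (A 0) (x, n) = 0)
    (hz : ∀ u v, zeroContr P (A u) (B v) = zeroContr P (B v) (A u)) :
    ExchangeRel P (fun u => nexp P (A u)) (fun v => nexp P (B v)) (fun _ _ => 1)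
      (fun _ _ => 1) := by
  refine exchangeRel_nexp hq hA hB (G₁ := fun _ => 1) (G₂ := fun _ => 1) (G₁' := fun _ => 1)
    (G₂' := fun _ => 1) (differentiable_const _) (differentiable_const _) (differentiable_const _)
    (differentiable_const _) ⟨1, one_ne_zero, one_ne_zero⟩ ⟨1, one_ne_zero, one_ne_zero⟩
    ⟨1, one_pos, fun y _ => ?_⟩ ⟨1, one_pos, fun y _ => ?_⟩ ⟨0, 0, one_ne_zero⟩ fun u v => ?_
  · simp [hAB]
  · simp [hBA]
  · rw [hz]

/-- Multiplying numerator and denominator by q^(νn) gives [mn]/[νn] = (q^((ν-m)n) - q^((ν+m)n))/(1 -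
q^(2νn)). The series is thus a difference of two logarithms from `qPoch_eq_exp`. -/
lemma exp_contraction {P : Params} (hq : P.logq.re < 0) {ν : ℝ} (hν : 0 < ν) (m β : ℂ)
    {c : ℕ+ → ℂ} (hc : ∀ n : ℕ+, c n =
      qnum P (m * (n : ℕ)) / qnum P (ν * (n : ℕ)) * qpow P (β * (n : ℕ)) / (n : ℕ)) :
    ∃ ρ : ℝ, 0 < ρ ∧ ∀ y : ℂ, ‖y‖ < ρ →
      qPoch (qpow P (ν - m + β) * y) (qpow P (2 * ν)) * Complex.exp (∑' n, c n * y ^ (n : ℕ)) =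
        qPoch (qpow P (ν + m + β) * y) (qpow P (2 * ν)) := by
  set a := qpow P (ν + m + β) with ha
  set b := qpow P (ν - m + β) with hb
  set t := qpow P (2 * ν) with ht
  have ht1 : ‖t‖ < 1 := norm_qpow_two_lt_one hq hν
  -- This radius makes |ay| and |by| less than 1, where the logarithmic expansions hold.
  refine ⟨(‖a‖ + ‖b‖ + 1)⁻¹, by positivity, fun y hy => ?_⟩
  have hpos : 0 < ‖a‖ + ‖b‖ + 1 := by positivity
  have hy' : (‖a‖ + ‖b‖ + 1) * ‖y‖ < 1 := by
    have := mul_lt_mul_of_pos_left hy hpos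
    rwa [mul_inv_cancel₀ hpos.ne'] at this
  have hay : ‖a * y‖ < 1 := by
    rw [norm_mul]
    nlinarith [norm_nonneg a, norm_nonneg b, norm_nonneg y,
      mul_nonneg (norm_nonneg b) (norm_nonneg y)]
  have hby : ‖b * y‖ < 1 := by
    rw [norm_mul]
    nlinarith [norm_nonneg a, norm_nonneg b, norm_nonneg y,
      mul_nonneg (norm_nonneg a) (norm_nonneg y)]
  have hterm : ∀ n : ℕ+, c n * y ^ (n : ℕ) =
      (b * y) ^ (n : ℕ) / ((n : ℕ) * (1 - t ^ (n : ℕ))) -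
        (a * y) ^ (n : ℕ) / ((n : ℕ) * (1 - t ^ (n : ℕ))) := by
    intro n
    have hn : ((n : ℕ) : ℂ) ≠ 0 := Nat.cast_ne_zero.2 n.pos.ne'
    have hνn : (ν * (n : ℕ) : ℝ) ≠ 0 := mul_ne_zero hν.ne' (Nat.cast_ne_zero.2 n.pos.ne')
    have h1 := qpow_sub_qpow_neg_ne_zero hq one_ne_zero
    have h2 := qpow_sub_qpow_neg_ne_zero hq hνn
    rw [Complex.ofReal_one] at h1
    push_cast at h2
    have hta : a ^ (n : ℕ) =
        qpow P (ν * (n : ℕ)) * qpow P (m * (n : ℕ)) * qpow P (β * (n : ℕ)) := by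
      rw [ha, ← qpow_mul_natCast, ← qpow_add, ← qpow_add]
      congr 1
      ring
    have htb : b ^ (n : ℕ) =
        qpow P (ν * (n : ℕ)) * qpow P (-(m * (n : ℕ))) * qpow P (β * (n : ℕ)) := by
      rw [hb, ← qpow_mul_natCast, ← qpow_add, ← qpow_add]
      congr 1
      ring
    have htt : t ^ (n : ℕ) = qpow P (ν * (n : ℕ)) * qpow P (ν * (n : ℕ)) := by
      rw [ht, ← qpow_mul_natCast, ← qpow_add]
      congr 1
      ring
    have h3 := qpow_ne_zero P (ν * (n : ℕ))
    have h4 : 1 - t ^ (n : ℕ) =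
        -qpow P (ν * (n : ℕ)) * (qpow P (ν * (n : ℕ)) - qpow P (-(ν * (n : ℕ)))) := by
      rw [htt, qpow_neg P (ν * (n : ℕ))]
      field_simp
      ring
    rw [hc, mul_pow, mul_pow, hta, htb, h4, qnum, qnum]
    clear hta htb htt h4 hc
    generalize qpow P (ν * (n : ℕ)) = N at *
    generalize qpow P (-(ν * (n : ℕ))) = N' at *
    generalize qpow P (m * (n : ℕ)) = M at *
    generalize qpow P (-(m * (n : ℕ))) = M' at *
    generalize qpow P (β * (n : ℕ)) = K at *
    generalize qpow P 1 - qpow P (-1) = d at *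
    generalize N - N' = D at *
    field_simp
    ring
  simp only [hterm]
  rw [(summable_qPoch_log hby ht1).tsum_sub (summable_qPoch_log hay ht1), qPoch_eq_exp hay ht1,
    qPoch_eq_exp hby ht1, ← Complex.exp_add]
  congr 1
  ring

/-- The numerator for one order and the denominator for the other have arguments with product
q^(2ν), so together they form one theta function. The shift of β from γ by ±ν decides which of them
plays (x;t)_∞ and which (t/x;t)_∞, that is, whether θ appears at u - v or at v - u. Oddness removes
the difference. -/
lemma exchangeRel_nexp_theta {P : Params} (hq : P.logq.re < 0) {ν : ℝ} (hν : 0 < ν)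
    {m β γ : ℂ} (hβ : β = γ - ν ∨ β = γ + ν) {A B : ℂ → Boselin}
    (hA : IsBosonField P A) (hB : IsBosonField P B)
    (hAB : ∀ n : ℕ+, ∑ x, oscContr P (A 0) (B 0) (x, n) =
      qnum P (m * (n : ℕ)) / qnum P (ν * (n : ℕ)) * qpow P (β * (n : ℕ)) / (n : ℕ))
    (hBA : ∀ n : ℕ+, ∑ x, oscContr P (B 0) (A 0) (x, n) =
      qnum P (m * (n : ℕ)) / qnum P (ν * (n : ℕ)) * qpow P (-β * (n : ℕ)) / (n : ℕ))
    (hz : ∀ u v, zeroContr P (A u) (B v) =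
      zeroContr P (B v) (A u) + m * (2 * (v - u) + β) / ν * P.logq) :
    ExchangeRel P (fun u => nexp P (A u)) (fun v => nexp P (B v))
      (fun u v => theta P ν (u - v - (m + γ) / 2)) (fun u v => theta P ν (u - v + (m - γ) / 2)) := by
  have hν0 : (ν : ℂ) ≠ 0 := Complex.ofReal_ne_zero.2 hν.ne'
  have ht := norm_qpow_two_lt_one hq hν
  have hG : ∀ α : ℂ, Differentiable ℂ fun y => qPoch (qpow P α * y) (qpow P (2 * ν)) := fun α =>
    (differentiable_qPoch ht).comp (differentiable_id.const_mul _)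
  -- The chosen y turns the argument into q^(2ν), inside the unit disc.
  have hne : ∀ α : ℂ, ∃ y, y ≠ 0 ∧ qPoch (qpow P α * y) (qpow P (2 * ν)) ≠ 0 := fun α =>
    ⟨(qpow P α)⁻¹ * qpow P (2 * ν), mul_ne_zero (inv_ne_zero (qpow_ne_zero _ _)) (qpow_ne_zero _ _),
      by
        rw [mul_inv_cancel_left₀ (qpow_ne_zero _ _)]
        exact qPoch_ne_zero ht ht⟩
  refine exchangeRel_nexp hq hA hB (hG (ν + m + β)) (hG (ν - m + β)) (hG (ν + m + -β))
    (hG (ν - m + -β)) (hne _) (hne _) (exp_contraction hq hν m β hAB)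
    (exp_contraction hq hν m (-β) hBA) ?_ fun u v => ?_
  · obtain ⟨w, hw⟩ := exists_theta_ne_zero hq hν
    refine ⟨w - (m - γ) / 2, 0, ?_⟩
    simpa using hw
  · set Z := zeroContr P (B v) (A u)
    rw [hz u v, Complex.exp_add]
    -- The zero modes contribute a pure power of q, which will be the quotient of the Gaussian
    -- prefactors.
    change _ * (_ * (_ * qpow P (m * (2 * (v - u) + β) / ν)) * _) = _
    simp only [← qpow_sub, ← qpow_add]
    rcases hβ with rfl | rfl
    · set W := v - u - (m - γ) / 2 with hW
      set U := v - u + (m + γ) / 2 with hU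
      have h1 : theta P ν (u - v + (m - γ) / 2) = -theta P ν W := by
        rw [← theta_neg hq hν, hW]
        congr 1
        ring
      have h2 : theta P ν (u - v - (m + γ) / 2) = -theta P ν U := by
        rw [← theta_neg hq hν, hU]
        congr 1
        ring
      -- Here U - W = m and U + W = 2(v - u) + γ, so (U² - W²)/ν - (U - W) is the zero-mode
      -- exponent.
      have h3 : qpow P (W ^ 2 / ν - W) * qpow P (m * (2 * (v - u) + (γ - ν)) / ν) =
          qpow P (U ^ 2 / ν - U) := by
        rw [← qpow_add]
        congr 1
        rw [hW, hU]
        field_simp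
        ring
      rw [h1, h2, theta_eq, theta_eq, ← h3,
        show (ν : ℂ) + m + (γ - ν) + (2 * v - 2 * u) = 2 * U by rw [hU]; ring,
        show (ν : ℂ) - m + -(γ - ν) + (2 * u - 2 * v) = 2 * ν - 2 * U by rw [hU]; ring,
        show (ν : ℂ) + m + -(γ - ν) + (2 * u - 2 * v) = 2 * ν - 2 * W by rw [hW]; ring,
        show (ν : ℂ) - m + (γ - ν) + (2 * v - 2 * u) = 2 * W by rw [hW]; ring]
      ring
    · set W := u - v + (m - γ) / 2 with hW
      set U := u - v - (m + γ) / 2 with hU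
      have h3 : qpow P (W ^ 2 / ν - W) * qpow P (m * (2 * (v - u) + (γ + ν)) / ν) =
          qpow P (U ^ 2 / ν - U) := by
        rw [← qpow_add]
        congr 1
        rw [hW, hU]
        field_simp
        ring
      rw [theta_eq, theta_eq, ← h3,
        show (ν : ℂ) + m + (γ + ν) + (2 * v - 2 * u) = 2 * ν - 2 * U by rw [hU]; ring,
        show (ν : ℂ) - m + -(γ + ν) + (2 * u - 2 * v) = 2 * U by rw [hU]; ring,
        show (ν : ℂ) + m + -(γ + ν) + (2 * u - 2 * v) = 2 * W by rw [hW]; ring,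
        show (ν : ℂ) - m + (γ + ν) + (2 * v - 2 * u) = 2 * ν - 2 * W by rw [hW]; ring]
      ring

end EllipticSl2

namespace EllipticSl2

/-! ### The currents and the vertex operators as boson fields -/

section Fields

variable {P : Params} {s : ℂ → ℂ}

lemma isBosonField_fPlus (x : Boson) (hs : ∀ u, s u = 2 * u + s 0) :
    IsBosonField P fun u => fPlus P x (s u) :=
  ((IsBosonField.annSum x (g := fun _ => 1) (GeomBounded.const 1) hs
    fun u n => (one_mul _).symm).const_smul _).add
    (.smul_of_momentum (by simp [pZ]) (by simp [pZ]) (by simp [pZ]) (differentiable_const _))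

lemma isBosonField_fMinus (x : Boson) (hs : ∀ u, s u = 2 * u + s 0) :
    IsBosonField P fun u => fMinus P x (s u) :=
  (((IsBosonField.creSum x (g := fun _ => 1) (GeomBounded.const 1) hs
    fun u n => (one_mul _).symm).const_smul _).add
    (.smul_of_momentum (by simp [pZ]) (by simp [pZ]) (by simp [pZ]) (differentiable_const _))).neg

lemma isBosonField_sPlus (hq : P.logq.re < 0) (hr : P.r ≠ 0) (x : Boson)
    (hs : ∀ u, s u = 2 * u + s 0) : IsBosonField P fun u => sPlus P x (s u) :=
  (IsBosonField.annSum x (GeomBounded.qnum_mul_inv hq hr) hs fun u n => by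
    rw [div_eq_inv_mul]).neg

lemma isBosonField_sMinus (hq : P.logq.re < 0) (hrs : P.rs ≠ 0) (x : Boson)
    (hs : ∀ u, s u = 2 * u + s 0) : IsBosonField P fun u => sMinus P x (s u) :=
  IsBosonField.creSum x (GeomBounded.qnum_mul_inv hq hrs) hs fun u n => by
    rw [div_eq_inv_mul]

lemma isBosonField_boson (hq : P.logq.re < 0) (x : Boson) (hs : ∀ u, s u = 2 * u + s 0) :
    IsBosonField P fun u => boson P x (s u) := by
  have h1 : GeomBounded fun n => (qnum P (n : ℕ))⁻¹ := by
    simpa using GeomBounded.qnum_mul_inv hq one_ne_zero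
  have h2 : GeomBounded fun n => (qnum P (-(n : ℕ)))⁻¹ := by
    simpa using GeomBounded.qnum_mul_inv hq (neg_ne_zero.2 one_ne_zero)
  have hsd : Differentiable ℂ s := by
    rw [funext hs]
    fun_prop
  refine ((((IsBosonField.annSum x (g := fun n => (qnum P n)⁻¹) h1 hs fun u n => ?_).neg.sub
    (IsBosonField.creSum x (g := fun n => (qnum P (-n))⁻¹) h2 hs fun u n => ?_)).add (.qZ _))).add
    (.smul_of_momentum (by simp [pZ]) (by simp [pZ]) (by simp [pZ]) (hsd.mul_const _))
  · rw [div_eq_inv_mul]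
  · rw [div_eq_inv_mul]

lemma isBosonField_bcField (hq : P.logq.re < 0) (hs : ∀ u, s u = 2 * u + s 0) :
    IsBosonField P fun u => bcField P (s u) :=
  (isBosonField_boson hq .b hs).add (isBosonField_boson hq .c hs)

/-- In `qRatio` the whole list is coerced from real to complex numbers; here the coercion acts on
the entries, so that explicit lists can be evaluated. -/
lemma qRatio_eq (P : Params) (L M : List ℝ) (n : ℕ) :
    qRatio P L M n = (L.map fun x : ℝ => qnum P (x * n)).prod /
      (M.map fun x : ℝ => qnum P (x * n)).prod := by
  have h : ∀ L : List ℝ, (do let a ← L; pure (a : ℂ) : List ℂ) = L.map fun x : ℝ => (x : ℂ) :=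
    fun L => bind_pure_comp _ _
  rw [qRatio, h, h, List.map_map, List.map_map]
  rfl

lemma geomBounded_qRatio (hq : P.logq.re < 0) (L : List ℝ) {M : List ℝ} (hM : ∀ x ∈ M, x ≠ 0) :
    GeomBounded fun n => qRatio P L M n := by
  have h1 : GeomBounded fun n => (L.map fun x : ℝ => qnum P (x * (n : ℕ))).prod := by
    induction L with
    | nil => simpa using GeomBounded.const 1
    | cons x L ih => simpa using (GeomBounded.qnum_mul P x).mul ih
  have h2 : GeomBounded fun n => ((M.map fun x : ℝ => qnum P (x * (n : ℕ))).prod)⁻¹ := by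
    induction M with
    | nil => simpa using GeomBounded.const 1
    | cons x M ih =>
      simp only [List.map_cons, List.prod_cons, mul_inv]
      exact (GeomBounded.qnum_mul_inv hq (hM x List.mem_cons_self)).mul
        (ih fun y hy => hM y (List.mem_cons_of_mem _ hy))
  simpa only [qRatio_eq] using h1.div h2

lemma isBosonField_lmPlus (hq : P.logq.re < 0) (x : Boson) (L : List ℝ) {M : List ℝ}
    (hM : ∀ x ∈ M, x ≠ 0) (α : ℝ) : IsBosonField P fun u => lmPlus P x L M (2 * u) α :=
  IsBosonField.annSum x (geomBounded_qRatio hq L hM) (s := fun u => 2 * u + α) (fun u => by ring)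
    fun u n => rfl

lemma isBosonField_lmMinus (hq : P.logq.re < 0) (x : Boson) (L : List ℝ) {M : List ℝ}
    (hM : ∀ x ∈ M, x ≠ 0) (α : ℝ) : IsBosonField P fun u => lmMinus P x L M (2 * u) α :=
  IsBosonField.creSum x (geomBounded_qRatio hq L hM) (s := fun u => 2 * u + α) (fun u => by ring)
    fun u n => rfl

lemma isBosonField_logUPlus (hq : P.logq.re < 0) (hrs : P.rs ≠ 0) (hs : ∀ u, s u = 2 * u + s 0) :
    IsBosonField P fun u => logUPlus P (s u) :=
  (isBosonField_sMinus hq hrs .a fun u => by rw [hs u]; ring).add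
    ((isBosonField_sMinus hq hrs .b fun u => by rw [hs u]; ring).add
      (isBosonField_sMinus hq hrs .b fun u => by rw [hs u]; ring))

lemma isBosonField_logUMinus (hq : P.logq.re < 0) (hr : P.r ≠ 0) (hs : ∀ u, s u = 2 * u + s 0) :
    IsBosonField P fun u => logUMinus P (s u) :=
  (isBosonField_sPlus hq hr .a fun u => by rw [hs u]; ring).add
    ((isBosonField_sPlus hq hr .b fun u => by rw [hs u]; ring).add
      (isBosonField_sPlus hq hr .b fun u => by rw [hs u]; ring))

lemma isBosonField_logPsiPlus : IsBosonField P fun u => logPsiPlus P (2 * u) :=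
  ((isBosonField_fPlus .b fun u => by ring).add (isBosonField_fPlus .a fun u => by ring)).add
    (isBosonField_fPlus .b fun u => by ring)

lemma isBosonField_logPsiMinus : IsBosonField P fun u => logPsiMinus P (2 * u) :=
  ((isBosonField_fMinus .b fun u => by ring).add (isBosonField_fMinus .a fun u => by ring)).add
    (isBosonField_fMinus .b fun u => by ring)

lemma isBosonField_smul_twoPbPa {f : ℂ → ℂ} (hf : Differentiable ℂ f) :
    IsBosonField P fun u => f u • twoPbPa :=
  .smul_of_momentum (by simp [twoPbPa, pZ]) (by simp [twoPbPa, pZ]) (by simp [twoPbPa, pZ]) hf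

lemma isBosonField_smul_pHatSubOne {f : ℂ → ℂ} (hf : Differentiable ℂ f) :
    IsBosonField P fun u => f u • pHatSubOne :=
  .smul_of_momentum (by simp [pHatSubOne, pZ, oneZ]) (by simp [pHatSubOne, pZ, oneZ])
    (by simp [pHatSubOne, pZ, oneZ]) hf

end Fields

/-- The exponent of `H⁺(u)`. -/
noncomputable def logHPlus (P : Params) (u : ℂ) : Boselin :=
  logUPlus P (2 * u + P.k / 2) + logPsiPlus P (2 * u) + logUMinus P (2 * u - P.k / 2)
    + (2 : ℂ) • qZ .hat
    + ((2 * u - P.k / 2) * P.logq / P.r) • twoPbPa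
    + ((2 * u + (P.r - P.k / 2)) * P.logq * (1 / P.r - 1 / P.rs)) • pHatSubOne

/-- The exponent of `H⁻(u)`. -/
noncomputable def logHMinus (P : Params) (u : ℂ) : Boselin :=
  logUPlus P (2 * u - P.k / 2) + logPsiMinus P (2 * u) + logUMinus P (2 * u + P.k / 2)
    + (2 : ℂ) • qZ .hat
    + ((2 * u + P.k / 2) * P.logq / P.r) • twoPbPa
    + ((2 * u - (P.r - P.k / 2)) * P.logq * (1 / P.r - 1 / P.rs)) • pHatSubOne

/-- The exponent of the first summand of `E(u)`. -/
noncomputable def logEPlus (P : Params) (u : ℂ) : Boselin :=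
  fPlus P .b (2 * u) - bcField P (2 * u + 1) +
    (logUPlus P (2 * u) + (2 : ℂ) • qZ .hat - (2 * u * P.logq / P.rs) • pHatSubOne)

/-- The exponent of the second summand of `E(u)`. -/
noncomputable def logEMinus (P : Params) (u : ℂ) : Boselin :=
  fMinus P .b (2 * u) - bcField P (2 * u - 1) +
    (logUPlus P (2 * u) + (2 : ℂ) • qZ .hat - (2 * u * P.logq / P.rs) • pHatSubOne)

/-- The exponent of the first summand of `F(u)`. -/
noncomputable def logFMinus (P : Params) (u : ℂ) : Boselin :=
  bcField P (2 * u - (P.k + 1)) + fMinus P .a (2 * u - (P.k + 2) / 2)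
    + fMinus P .b (2 * u - (P.k + 2)) +
    (logUMinus P (2 * u) + (2 * u * P.logq / P.r) • twoPbPa
      + (2 * u * P.logq / P.r) • pHatSubOne)

/-- The exponent of the second summand of `F(u)`. -/
noncomputable def logFPlus (P : Params) (u : ℂ) : Boselin :=
  bcField P (2 * u + (P.k + 1)) + fPlus P .a (2 * u + (P.k + 2) / 2)
    + fPlus P .b (2 * u + (P.k + 2)) +
    (logUMinus P (2 * u) + (2 * u * P.logq / P.r) • twoPbPa
      + (2 * u * P.logq / P.r) • pHatSubOne)

/-- The exponent of `Φ_{l,l}(v)`. -/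
noncomputable def logPhi (P : Params) (l : ℕ) (v : ℂ) : Boselin :=
  logVPlus P l (2 * v)
    + (lmMinus P .a [(l : ℝ)] [2, P.k + 2] (2 * v) ((P.k + 2) / 2)
      + lmPlus P .a [(l : ℝ)] [P.k, P.k + 2] (2 * v) ((P.k + 2) / 2)
      + lmPlus P .b [(l : ℝ)] [1, P.k] (2 * v) 1)
    + ((l / (2 * (P.k + 2)) : ℂ) • qZ .a
      - (l / (2 * P.r) * (2 * v * P.logq) : ℂ) • ((2 : ℂ) • pZ .b + pZ .hat))

/-- The exponent of `Ψ*_{l,l}(v)`. -/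
noncomputable def logPsiStar (P : Params) (l : ℕ) (v : ℂ) : Boselin :=
  logVMinus P l (2 * v)
    + (-lmMinus P .a [-(l : ℝ), P.k + 1] [1, P.k, P.k + 2] (2 * v) (-((P.k + 2) / 2))
      + lmPlus P .a [-(l : ℝ)] [2, P.k + 2] (2 * v) ((P.k + 2) / 2)
      - lmMinus P .b [-(l : ℝ), P.k + 1] [1, 1, P.k] (2 * v) (-1)
      + lmPlus P .b [-(l : ℝ)] [1, 1] (2 * v) 0
      - lmMinus P .c [-(l : ℝ)] [1, 1] (2 * v) 0
      + lmPlus P .c [-(l : ℝ)] [1, 1] (2 * v) 0)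
    + ((l / (2 * (P.k + 2)) : ℂ) • qZ .a + (l : ℂ) • (qZ .b + qZ .c) - (l : ℂ) • qZ .hat
      + (l / (2 * P.rs) * (2 * v * P.logq) : ℂ) • pZ .hat)

section Exponents

variable {P : Params}

lemma isBosonField_logHPlus (hq : P.logq.re < 0) (hr : P.r ≠ 0) (hrs : P.rs ≠ 0) :
    IsBosonField P (logHPlus P) :=
  (((((isBosonField_logUPlus hq hrs fun u => by ring).add isBosonField_logPsiPlus).add
    (isBosonField_logUMinus hq hr fun u => by ring)).add ((IsBosonField.qZ _).const_smul _)).add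
    (isBosonField_smul_twoPbPa (by fun_prop))).add (isBosonField_smul_pHatSubOne (by fun_prop))

lemma isBosonField_logHMinus (hq : P.logq.re < 0) (hr : P.r ≠ 0) (hrs : P.rs ≠ 0) :
    IsBosonField P (logHMinus P) :=
  (((((isBosonField_logUPlus hq hrs fun u => by ring).add isBosonField_logPsiMinus).add
    (isBosonField_logUMinus hq hr fun u => by ring)).add ((IsBosonField.qZ _).const_smul _)).add
    (isBosonField_smul_twoPbPa (by fun_prop))).add (isBosonField_smul_pHatSubOne (by fun_prop))

lemma isBosonField_logEPlus (hq : P.logq.re < 0) (hrs : P.rs ≠ 0) :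
    IsBosonField P (logEPlus P) :=
  ((isBosonField_fPlus .b fun u => by ring).sub (isBosonField_bcField hq fun u => by ring)).add
    (((isBosonField_logUPlus hq hrs fun u => by ring).add ((IsBosonField.qZ _).const_smul _)).sub
      (isBosonField_smul_pHatSubOne (by fun_prop)))

lemma isBosonField_logEMinus (hq : P.logq.re < 0) (hrs : P.rs ≠ 0) :
    IsBosonField P (logEMinus P) :=
  ((isBosonField_fMinus .b fun u => by ring).sub (isBosonField_bcField hq fun u => by ring)).add
    (((isBosonField_logUPlus hq hrs fun u => by ring).add ((IsBosonField.qZ _).const_smul _)).sub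
      (isBosonField_smul_pHatSubOne (by fun_prop)))

lemma isBosonField_logFMinus (hq : P.logq.re < 0) (hr : P.r ≠ 0) :
    IsBosonField P (logFMinus P) :=
  (((isBosonField_bcField hq fun u => by ring).add (isBosonField_fMinus .a fun u => by ring)).add
    (isBosonField_fMinus .b fun u => by ring)).add
    (((isBosonField_logUMinus hq hr fun u => by ring).add
      (isBosonField_smul_twoPbPa (by fun_prop))).add (isBosonField_smul_pHatSubOne (by fun_prop)))

lemma isBosonField_logFPlus (hq : P.logq.re < 0) (hr : P.r ≠ 0) :
    IsBosonField P (logFPlus P) :=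
  (((isBosonField_bcField hq fun u => by ring).add (isBosonField_fPlus .a fun u => by ring)).add
    (isBosonField_fPlus .b fun u => by ring)).add
    (((isBosonField_logUMinus hq hr fun u => by ring).add
      (isBosonField_smul_twoPbPa (by fun_prop))).add (isBosonField_smul_pHatSubOne (by fun_prop)))

lemma isBosonField_logPhi (hq : P.logq.re < 0) (hr : P.r ≠ 0) (hk0 : P.k ≠ 0)
    (hk2 : P.k + 2 ≠ 0) (l : ℕ) : IsBosonField P (logPhi P l) :=
  (((isBosonField_lmPlus hq .a _ (by simp [*]) _).neg.sub
      (isBosonField_lmPlus hq .b _ (by simp [*]) _)).add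
    (((isBosonField_lmMinus hq .a _ (by simp [*]) _).add
      (isBosonField_lmPlus hq .a _ (by simp [*]) _)).add
      (isBosonField_lmPlus hq .b _ (by simp [*]) _))).add
    (((IsBosonField.qZ _).const_smul _).sub
      (.smul_of_momentum (by simp [pZ]) (by simp [pZ]) (by simp [pZ]) (by fun_prop)))

lemma isBosonField_logPsiStar (hq : P.logq.re < 0) (hrs : P.rs ≠ 0) (hk0 : P.k ≠ 0)
    (hk2 : P.k + 2 ≠ 0) (l : ℕ) : IsBosonField P (logPsiStar P l) :=
  (((isBosonField_lmMinus hq .a _ (by simp [*]) _).add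
      (isBosonField_lmMinus hq .b _ (by simp [*]) _)).add
    ((((((isBosonField_lmMinus hq .a _ (by simp [*]) _).neg.add
      (isBosonField_lmPlus hq .a _ (by simp [*]) _)).sub
      (isBosonField_lmMinus hq .b _ (by simp [*]) _)).add
      (isBosonField_lmPlus hq .b _ (by simp [*]) _)).sub
      (isBosonField_lmMinus hq .c _ (by simp [*]) _)).add
      (isBosonField_lmPlus hq .c _ (by simp [*]) _))).add
    (((((IsBosonField.qZ _).const_smul _).add
      (((IsBosonField.qZ _).add (IsBosonField.qZ _)).const_smul _)).sub
      ((IsBosonField.qZ _).const_smul _)).add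
      (.smul_of_momentum (by simp [pZ]) (by simp [pZ]) (by simp [pZ]) (by fun_prop)))

end Exponents

end EllipticSl2

namespace EllipticSl2

/-! ### Contractions of the currents with the vertex operators -/

lemma sum_boson (f : Boson → ℂ) : ∑ x, f x = f .a + f .b + f .c := by
  simp [Finset.sum, Finset.univ, Fintype.elems, add_assoc]

lemma qnum_neg (P : Params) (x : ℂ) : qnum P (-x) = -qnum P x := by
  rw [qnum, qnum, neg_neg, ← neg_div, neg_sub]

/-- The values of the powers of `q` and of the `q`-numbers which occur in contractions. -/
lemma exists_mode_values {P : Params} (hq : P.logq.re < 0) (hr : P.r ≠ 0) (hrs : P.rs ≠ 0)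
    (hk0 : P.k ≠ 0) (hk2 : P.k + 2 ≠ 0) (l : ℕ) (n : ℕ+) :
    ∃ Q K R L d N₁ N₂ Nk Nk₂ Nr Ns : ℂ, Q ≠ 0 ∧ K ≠ 0 ∧ R ≠ 0 ∧ L ≠ 0 ∧ d ≠ 0 ∧ N₁ ≠ 0 ∧ N₂ ≠ 0 ∧
      Nk ≠ 0 ∧ Nk₂ ≠ 0 ∧ Nr ≠ 0 ∧ Ns ≠ 0 ∧
      ((n : ℕ) : ℂ) ≠ 0 ∧
      qpow P (n : ℕ) = Q ∧ qpow P (2 * (n : ℕ)) = Q ^ 2 ∧ qpow P (P.k / 2 * (n : ℕ)) = K ∧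
      qpow P (P.k * (n : ℕ)) = K ^ 2 ∧ qpow P (P.r * (n : ℕ)) = R ∧
      qpow P 1 - (qpow P 1)⁻¹ = d ∧ qnum P (n : ℕ) = N₁ ∧ qnum P (2 * (n : ℕ)) = N₂ ∧
      qnum P (P.k * (n : ℕ)) = Nk ∧ qnum P (P.k * (n : ℕ) + 2 * (n : ℕ)) = Nk₂ ∧
      qnum P (P.r * (n : ℕ)) = Nr ∧ qnum P (P.r * (n : ℕ) - P.k * (n : ℕ)) = Ns ∧
      qnum P (P.k * (n : ℕ) + (n : ℕ)) = (K ^ 2 * Q - (K ^ 2 * Q)⁻¹) / d ∧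
      qnum P (l * (n : ℕ)) = (L - L⁻¹) / d ∧ N₁ = (Q - Q⁻¹) / d ∧ N₂ = (Q ^ 2 - (Q ^ 2)⁻¹) / d ∧
      Nk = (K ^ 2 - (K ^ 2)⁻¹) / d ∧ Nk₂ = (K ^ 2 * Q ^ 2 - (K ^ 2 * Q ^ 2)⁻¹) / d ∧
      Nr = (R - R⁻¹) / d ∧ Ns = (R / K ^ 2 - (R / K ^ 2)⁻¹) / d := by
  have hn : (n : ℕ) ≠ 0 := n.pos.ne'
  have hn' : ((n : ℕ) : ℝ) ≠ 0 := Nat.cast_ne_zero.2 hn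
  have h2 : qpow P (2 * (n : ℕ)) = qpow P (n : ℕ) ^ 2 := by
    rw [two_mul, qpow_add, sq]
  have hk : qpow P (P.k * (n : ℕ)) = qpow P (P.k / 2 * (n : ℕ)) ^ 2 := by
    rw [sq, ← qpow_add]
    congr 1
    ring
  have hd := qpow_sub_qpow_neg_ne_zero hq one_ne_zero
  rw [Complex.ofReal_one, qpow_neg] at hd
  have hN : ∀ x : ℝ, x ≠ 0 → qnum P (x * (n : ℕ)) ≠ 0 := fun x hx => by
    have := qnum_ne_zero hq (mul_ne_zero hx hn')
    push_cast at this
    exact this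
  have hN₁ := hN 1 one_ne_zero
  have hN₂ := hN 2 two_ne_zero
  have hNk₂ := hN (P.k + 2) hk2
  have hNs := hN (P.r - P.k) hrs
  push_cast at hN₁ hN₂ hNk₂ hNs
  rw [one_mul] at hN₁
  rw [add_mul] at hNk₂
  rw [sub_mul] at hNs
  refine ⟨_, _, _, qpow P (l * (n : ℕ)), _, _, _, _, _, _, _, qpow_ne_zero _ _,
    qpow_ne_zero _ _, qpow_ne_zero _ _, qpow_ne_zero _ _, hd, hN₁, hN₂, hN P.k hk0, hNk₂, hN P.r hr,
    hNs, Nat.cast_ne_zero.2 hn, rfl,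
    h2, rfl, hk, rfl, rfl, rfl, rfl, rfl, rfl, rfl, rfl, ?_, ?_, ?_, ?_, ?_, ?_, ?_, ?_⟩ <;>
  simp only [qnum, qpow_neg, qpow_add, qpow_sub, h2, hk]

set_option linter.unusedSimpArgs false
set_option linter.unnecessarySeqFocus false

set_option maxHeartbeats 4000000 in
/-- The contractions of `Φ_{l,l}` with the currents. -/
lemma sum_oscContr_logPhi {P : Params} (hq : P.logq.re < 0) (hr : P.r ≠ 0) (hrs : P.rs ≠ 0)
    (hk0 : P.k ≠ 0) (hk2 : P.k + 2 ≠ 0) (l : ℕ) (n : ℕ+) :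
    (∑ x, oscContr P (logHPlus P 0) (logPhi P l 0) (x, n) =
      qnum P (-l * (n : ℕ)) / qnum P (P.r * (n : ℕ)) *
        qpow P ((P.k / 2 - P.r) * (n : ℕ)) / (n : ℕ)) ∧
    (∑ x, oscContr P (logPhi P l 0) (logHPlus P 0) (x, n) =
      qnum P (-l * (n : ℕ)) / qnum P (P.r * (n : ℕ)) *
        qpow P (-(P.k / 2 - P.r) * (n : ℕ)) / (n : ℕ)) ∧
    (∑ x, oscContr P (logHMinus P 0) (logPhi P l 0) (x, n) =
      qnum P (-l * (n : ℕ)) / qnum P (P.r * (n : ℕ)) *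
        qpow P ((-(P.k / 2) + P.r) * (n : ℕ)) / (n : ℕ)) ∧
    (∑ x, oscContr P (logPhi P l 0) (logHMinus P 0) (x, n) =
      qnum P (-l * (n : ℕ)) / qnum P (P.r * (n : ℕ)) *
        qpow P (-(-(P.k / 2) + P.r) * (n : ℕ)) / (n : ℕ)) ∧
    (∑ x, oscContr P (logEPlus P 0) (logPhi P l 0) (x, n) = 0) ∧
    (∑ x, oscContr P (logPhi P l 0) (logEPlus P 0) (x, n) = 0) ∧
    (∑ x, oscContr P (logEMinus P 0) (logPhi P l 0) (x, n) = 0) ∧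
    (∑ x, oscContr P (logPhi P l 0) (logEMinus P 0) (x, n) = 0) ∧
    (∑ x, oscContr P (logFMinus P 0) (logPhi P l 0) (x, n) =
      qnum P (-l * (n : ℕ)) / qnum P (P.r * (n : ℕ)) *
        qpow P (P.r * (n : ℕ)) / (n : ℕ)) ∧
    (∑ x, oscContr P (logPhi P l 0) (logFMinus P 0) (x, n) =
      qnum P (-l * (n : ℕ)) / qnum P (P.r * (n : ℕ)) *
        qpow P (-P.r * (n : ℕ)) / (n : ℕ)) ∧
    (∑ x, oscContr P (logFPlus P 0) (logPhi P l 0) (x, n) =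
      qnum P (-l * (n : ℕ)) / qnum P (P.r * (n : ℕ)) *
        qpow P (-P.r * (n : ℕ)) / (n : ℕ)) ∧
    (∑ x, oscContr P (logPhi P l 0) (logFPlus P 0) (x, n) =
      qnum P (-l * (n : ℕ)) / qnum P (P.r * (n : ℕ)) *
        qpow P (-(-P.r) * (n : ℕ)) / (n : ℕ)) := by
  -- Every claim becomes an identity of rational functions in Q = q^n, K = q^(kn/2), R = q^(rn) and
  -- L = q^(ln). The q-numbers N that occur in denominators stay opaque while they cancel and are
  -- expanded only afterwards through the f's.
  obtain ⟨Q, K, R, L, d, N₁, N₂, Nk, Nk₂, Nr, Ns, hQ, hK, hR, hL, hd, hN₁, hN₂, hNk, hNk₂, hNr, hNs,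
    hn, e₁, e₂, e₃, e₄, e₅, e₆, e₇, e₈, e₉, e₁₀, e₁₁, e₁₂, e₁₃, e₁₄, f₁, f₂, f₃, f₄, f₅, f₆⟩ :=
    exists_mode_values hq hr hrs hk0 hk2 l n
  refine ⟨?_, ?_, ?_, ?_, ?_, ?_, ?_, ?_, ?_, ?_, ?_, ?_⟩ <;>
  simp only [sum_boson, oscContr, logHPlus, logHMinus, logEPlus, logEMinus, logFPlus, logFMinus,
    logPhi, logVPlus, lmMinus, lmPlus, logUPlus, logUMinus, logPsiPlus, logPsiMinus, bcField, boson, sPlus, sMinus,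
    fPlus, fMinus, twoPbPa, pHatSubOne, Pi.add_apply, Pi.sub_apply, Pi.neg_apply, Pi.smul_apply,
    annSum, creSum, qZ, pZ, oneZ, smul_eq_mul, mul_zero, add_zero, zero_add, sub_zero, zero_sub,
    if_true, reduceCtorEq, if_false, zero_mul, neg_zero, oscComm, qRatio_eq, List.map_cons,
    List.map_nil, List.prod_cons, List.prod_nil, mul_one] <;>
  push_cast <;>
  simp only [Params.rs, Complex.ofReal_sub, add_mul, sub_mul, neg_mul, add_div, sub_div, qpow_add,
    qpow_sub, qpow_neg, one_mul, zero_mul, qpow_zero, neg_add, neg_sub, qnum_neg,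
    div_self (two_ne_zero' ℂ), e₁, e₂, e₃, e₄, e₅, e₆, e₇, e₈, e₉, e₁₀, e₁₁, e₁₂, e₁₃, e₁₄] <;>
  clear e₁ e₂ e₃ e₄ e₅ e₆ e₇ e₈ e₉ e₁₀ e₁₁ e₁₂ e₁₃ e₁₄ <;>
  field_simp <;>
  (try simp only [f₁, f₂, f₃, f₄, f₅, f₆]) <;>
  (try field_simp) <;>
  ring

set_option maxHeartbeats 4000000 in
/-- The contractions of `Ψ*_{l,l}` with the currents. -/
lemma sum_oscContr_logPsiStar {P : Params} (hq : P.logq.re < 0) (hr : P.r ≠ 0) (hrs : P.rs ≠ 0)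
    (hk0 : P.k ≠ 0) (hk2 : P.k + 2 ≠ 0) (l : ℕ) (n : ℕ+) :
    (∑ x, oscContr P (logHPlus P 0) (logPsiStar P l 0) (x, n) =
      qnum P (l * (n : ℕ)) / qnum P (P.rs * (n : ℕ)) *
        qpow P ((P.k / 2 - P.r) * (n : ℕ)) / (n : ℕ)) ∧
    (∑ x, oscContr P (logPsiStar P l 0) (logHPlus P 0) (x, n) =
      qnum P (l * (n : ℕ)) / qnum P (P.rs * (n : ℕ)) *
        qpow P (-(P.k / 2 - P.r) * (n : ℕ)) / (n : ℕ)) ∧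
    (∑ x, oscContr P (logHMinus P 0) (logPsiStar P l 0) (x, n) =
      qnum P (l * (n : ℕ)) / qnum P (P.rs * (n : ℕ)) *
        qpow P ((-(P.k / 2) + P.r) * (n : ℕ)) / (n : ℕ)) ∧
    (∑ x, oscContr P (logPsiStar P l 0) (logHMinus P 0) (x, n) =
      qnum P (l * (n : ℕ)) / qnum P (P.rs * (n : ℕ)) *
        qpow P (-(-(P.k / 2) + P.r) * (n : ℕ)) / (n : ℕ)) ∧
    (∑ x, oscContr P (logFMinus P 0) (logPsiStar P l 0) (x, n) = 0) ∧
    (∑ x, oscContr P (logPsiStar P l 0) (logFMinus P 0) (x, n) = 0) ∧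
    (∑ x, oscContr P (logFPlus P 0) (logPsiStar P l 0) (x, n) = 0) ∧
    (∑ x, oscContr P (logPsiStar P l 0) (logFPlus P 0) (x, n) = 0) ∧
    (∑ x, oscContr P (logEPlus P 0) (logPsiStar P l 0) (x, n) =
      qnum P (l * (n : ℕ)) / qnum P (P.rs * (n : ℕ)) *
        qpow P (-P.rs * (n : ℕ)) / (n : ℕ)) ∧
    (∑ x, oscContr P (logPsiStar P l 0) (logEPlus P 0) (x, n) =
      qnum P (l * (n : ℕ)) / qnum P (P.rs * (n : ℕ)) *
        qpow P (-(-P.rs) * (n : ℕ)) / (n : ℕ)) ∧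
    (∑ x, oscContr P (logEMinus P 0) (logPsiStar P l 0) (x, n) =
      qnum P (l * (n : ℕ)) / qnum P (P.rs * (n : ℕ)) *
        qpow P (P.rs * (n : ℕ)) / (n : ℕ)) ∧
    (∑ x, oscContr P (logPsiStar P l 0) (logEMinus P 0) (x, n) =
      qnum P (l * (n : ℕ)) / qnum P (P.rs * (n : ℕ)) *
        qpow P (-P.rs * (n : ℕ)) / (n : ℕ)) := by
  obtain ⟨Q, K, R, L, d, N₁, N₂, Nk, Nk₂, Nr, Ns, hQ, hK, hR, hL, hd, hN₁, hN₂, hNk, hNk₂, hNr, hNs,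
    hn, e₁, e₂, e₃, e₄, e₅, e₆, e₇, e₈, e₉, e₁₀, e₁₁, e₁₂, e₁₃, e₁₄, f₁, f₂, f₃, f₄, f₅, f₆⟩ :=
    exists_mode_values hq hr hrs hk0 hk2 l n
  refine ⟨?_, ?_, ?_, ?_, ?_, ?_, ?_, ?_, ?_, ?_, ?_, ?_⟩ <;>
  simp only [sum_boson, oscContr, logHPlus, logHMinus, logEPlus, logEMinus, logFPlus, logFMinus,
    logPsiStar, logVMinus, lmMinus, lmPlus, logUPlus, logUMinus, logPsiPlus, logPsiMinus, bcField, boson, sPlus, sMinus,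
    fPlus, fMinus, twoPbPa, pHatSubOne, Pi.add_apply, Pi.sub_apply, Pi.neg_apply, Pi.smul_apply,
    annSum, creSum, qZ, pZ, oneZ, smul_eq_mul, mul_zero, add_zero, zero_add, sub_zero, zero_sub,
    if_true, reduceCtorEq, if_false, zero_mul, neg_zero, oscComm, qRatio_eq, List.map_cons,
    List.map_nil, List.prod_cons, List.prod_nil, mul_one] <;>
  push_cast <;>
  simp only [Params.rs, Complex.ofReal_sub, add_mul, sub_mul, neg_mul, add_div, sub_div, qpow_add,
    qpow_sub, qpow_neg, one_mul, zero_mul, qpow_zero, neg_add, neg_sub, qnum_neg,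
    div_self (two_ne_zero' ℂ), e₁, e₂, e₃, e₄, e₅, e₆, e₇, e₈, e₉, e₁₀, e₁₁, e₁₂, e₁₃, e₁₄] <;>
  clear e₁ e₂ e₃ e₄ e₅ e₆ e₇ e₈ e₉ e₁₀ e₁₁ e₁₂ e₁₃ e₁₄ <;>
  field_simp <;>
  (try simp only [f₁, f₂, f₃, f₄, f₅, f₆]) <;>
  (try field_simp) <;>
  ring

end EllipticSl2

/-! ### Contractions of the zero modes. -/

namespace EllipticSl2

lemma ExchangeRel.congr {P : Params} {X Y : ℂ → Op} {num den num' den' : ℂ → ℂ → ℂ}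
    (h : ExchangeRel P X Y num den) (hn : ∀ u v, num' u v = num u v)
    (hd : ∀ u v, den' u v = den u v) : ExchangeRel P X Y num' den' := by
  obtain rfl : num' = num := funext fun u => funext (hn u)
  obtain rfl : den' = den := funext fun u => funext (hd u)
  exact h

set_option maxHeartbeats 4000000 in
/-- The zero mode contractions of `Φ_{l,l}` with the currents. -/
lemma zeroContr_logPhi {P : Params} (hr : P.r ≠ 0) (hrs : P.rs ≠ 0) (hk2 : P.k + 2 ≠ 0) (l : ℕ)
    (u v : ℂ) :
    (zeroContr P (logHPlus P u) (logPhi P l v) = zeroContr P (logPhi P l v) (logHPlus P u) +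
      -l * (2 * (v - u) + (P.k / 2 - P.r)) / P.r * P.logq) ∧
    (zeroContr P (logHMinus P u) (logPhi P l v) = zeroContr P (logPhi P l v) (logHMinus P u) +
      -l * (2 * (v - u) + (-(P.k / 2) + P.r)) / P.r * P.logq) ∧
    (zeroContr P (logEPlus P u) (logPhi P l v) = zeroContr P (logPhi P l v) (logEPlus P u)) ∧
    (zeroContr P (logEMinus P u) (logPhi P l v) = zeroContr P (logPhi P l v) (logEMinus P u)) ∧
    (zeroContr P (logFMinus P u) (logPhi P l v) = zeroContr P (logPhi P l v) (logFMinus P u) +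
      -l * (2 * (v - u) + P.r) / P.r * P.logq) ∧
    (zeroContr P (logFPlus P u) (logPhi P l v) = zeroContr P (logPhi P l v) (logFPlus P u) +
      -l * (2 * (v - u) + (-P.r)) / P.r * P.logq) := by
  have hr' : (P.r : ℂ) ≠ 0 := Complex.ofReal_ne_zero.2 hr
  have hrs' : (P.rs : ℂ) ≠ 0 := Complex.ofReal_ne_zero.2 hrs
  have hk' : (P.k : ℂ) + 2 ≠ 0 := by exact_mod_cast hk2
  refine ⟨?_, ?_, ?_, ?_, ?_, ?_⟩ <;>
  simp only [zeroContr, zeroComm, logHPlus, logHMinus, logEPlus, logEMinus, logFPlus, logFMinus,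
    logPhi, logVPlus, lmMinus, lmPlus, logUPlus, logUMinus, logPsiPlus, logPsiMinus, bcField,
    boson, Boson.zero, sPlus, sMinus, fPlus, fMinus, twoPbPa, pHatSubOne, Pi.add_apply,
    Pi.sub_apply, Pi.neg_apply, Pi.smul_apply, annSum, creSum, qZ, pZ, oneZ, smul_eq_mul, mul_zero,
    add_zero, zero_add, sub_zero, zero_sub, if_true, reduceCtorEq, if_false, zero_mul, neg_zero,
    mul_one] <;>
  field_simp <;>
  ring

set_option maxHeartbeats 4000000 in
/-- The zero mode contractions of `Ψ*_{l,l}` with the currents. -/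
lemma zeroContr_logPsiStar {P : Params} (hr : P.r ≠ 0) (hrs : P.rs ≠ 0) (hk2 : P.k + 2 ≠ 0) (l : ℕ)
    (u v : ℂ) :
    (zeroContr P (logHPlus P u) (logPsiStar P l v) = zeroContr P (logPsiStar P l v) (logHPlus P u) +
      l * (2 * (v - u) + (P.k / 2 - P.r)) / P.rs * P.logq) ∧
    (zeroContr P (logHMinus P u) (logPsiStar P l v) = zeroContr P (logPsiStar P l v) (logHMinus P u) +
      l * (2 * (v - u) + (-(P.k / 2) + P.r)) / P.rs * P.logq) ∧
    (zeroContr P (logFMinus P u) (logPsiStar P l v) =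
      zeroContr P (logPsiStar P l v) (logFMinus P u)) ∧
    (zeroContr P (logFPlus P u) (logPsiStar P l v) =
      zeroContr P (logPsiStar P l v) (logFPlus P u)) ∧
    (zeroContr P (logEPlus P u) (logPsiStar P l v) = zeroContr P (logPsiStar P l v) (logEPlus P u) +
      l * (2 * (v - u) + (-P.rs)) / P.rs * P.logq) ∧
    (zeroContr P (logEMinus P u) (logPsiStar P l v) = zeroContr P (logPsiStar P l v) (logEMinus P u) +
      l * (2 * (v - u) + P.rs) / P.rs * P.logq) := by
  have hr' : (P.r : ℂ) ≠ 0 := Complex.ofReal_ne_zero.2 hr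
  have hrs' : (P.rs : ℂ) ≠ 0 := Complex.ofReal_ne_zero.2 hrs
  have hk' : (P.k : ℂ) + 2 ≠ 0 := by exact_mod_cast hk2
  -- Denominators are cleared with r and r* as unrelated symbols; r = r* + k enters afterwards.
  have hs : (P.r : ℂ) = P.rs + P.k := by simp [Params.rs]
  refine ⟨?_, ?_, ?_, ?_, ?_, ?_⟩ <;>
  simp only [zeroContr, zeroComm, logHPlus, logHMinus, logEPlus, logEMinus, logFPlus, logFMinus,
    logPsiStar, logVMinus, lmMinus, lmPlus, logUPlus, logUMinus, logPsiPlus, logPsiMinus, bcField,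
    boson, Boson.zero, sPlus, sMinus, fPlus, fMinus, twoPbPa, pHatSubOne, Pi.add_apply,
    Pi.sub_apply, Pi.neg_apply, Pi.smul_apply, annSum, creSum, qZ, pZ, oneZ, smul_eq_mul, mul_zero,
    add_zero, zero_add, sub_zero, zero_sub, if_true, reduceCtorEq, if_false, zero_mul, neg_zero,
    mul_one] <;>
  field_simp <;>
  (try rw [hs]) <;>
  ring

end EllipticSl2

/-! ### Assembly of the exchange relations. -/

namespace EllipticSl2

/-- The factor 1/z is entire in u because z = q^(2u) has no zero; this is what `ExchangeRel.smul`
requires. -/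
lemma differentiable_current_prefactor {P : Params} (hq : P.logq.re < 0) :
    Differentiable ℂ fun u => -1 / ((qpow P 1 - qpow P (-1)) * qpow P (2 * u)) := by
  have hd := qpow_sub_qpow_neg_ne_zero hq one_ne_zero
  rw [Complex.ofReal_one] at hd
  exact (differentiable_const _).div
    (((differentiable_qpow P).comp (differentiable_id.const_mul 2)).const_mul _)
    fun u => mul_ne_zero hd (qpow_ne_zero _ _)

section Relations

variable {P : Params}

lemma exchangeRel_E {Y : ℂ → Op} {num den : ℂ → ℂ → ℂ} (hq : P.logq.re < 0)
    (h : ExchangeRel P (fun u => nexp P (logEPlus P u)) Y num den)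
    (h' : ExchangeRel P (fun u => nexp P (logEMinus P u)) Y num den) :
    ExchangeRel P (E P) Y num den :=
  (h.sub h').smul (differentiable_current_prefactor hq)

lemma exchangeRel_F {Y : ℂ → Op} {num den : ℂ → ℂ → ℂ} (hq : P.logq.re < 0)
    (h : ExchangeRel P (fun u => nexp P (logFMinus P u)) Y num den)
    (h' : ExchangeRel P (fun u => nexp P (logFPlus P u)) Y num den) :
    ExchangeRel P (F P) Y num den :=
  (h.sub h').smul (differentiable_current_prefactor hq)

end Relations

end EllipticSl2

open EllipticSl2 in
theorem theorem3 (P : Params) (hq : P.logq.re < 0) (hr : 0 < P.r) (hrs : 0 < P.rs)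
    (hk0 : P.k ≠ 0) (hk2 : P.k ≠ -2) (l : ℕ) :
    ExchangeRel P (HPlus P) (Phi P l)
      (fun u v => theta P P.r (u - v + l / 2 - P.k / 4))
      (fun u v => theta P P.r (u - v - l / 2 - P.k / 4)) ∧
    ExchangeRel P (HMinus P) (Phi P l)
      (fun u v => theta P P.r (u - v + l / 2 + P.k / 4))
      (fun u v => theta P P.r (u - v - l / 2 + P.k / 4)) ∧
    ExchangeRel P (E P) (Phi P l) (fun _ _ => 1) (fun _ _ => 1) ∧
    ExchangeRel P (F P) (Phi P l)
      (fun u v => theta P P.r (u - v + l / 2))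
      (fun u v => theta P P.r (u - v - l / 2)) ∧
    ExchangeRel P (HPlus P) (PsiStar P l)
      (fun u v => theta P P.rs (u - v - l / 2 + P.k / 4))
      (fun u v => theta P P.rs (u - v + l / 2 + P.k / 4)) ∧
    ExchangeRel P (HMinus P) (PsiStar P l)
      (fun u v => theta P P.rs (u - v - l / 2 - P.k / 4))
      (fun u v => theta P P.rs (u - v + l / 2 - P.k / 4)) ∧
    ExchangeRel P (F P) (PsiStar P l) (fun _ _ => 1) (fun _ _ => 1) ∧
    ExchangeRel P (E P) (PsiStar P l)
      (fun u v => theta P P.rs (u - v - l / 2))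
      (fun u v => theta P P.rs (u - v + l / 2)) := by
  have hk2' : P.k + 2 ≠ 0 := fun h => hk2 (by linarith)
  have hrs' : (P.rs : ℂ) = P.r - P.k := by simp [Params.rs]
  have hHp := isBosonField_logHPlus hq hr.ne' hrs.ne'
  have hHm := isBosonField_logHMinus hq hr.ne' hrs.ne'
  have hEp := isBosonField_logEPlus hq hrs.ne'
  have hEm := isBosonField_logEMinus hq hrs.ne'
  have hFm := isBosonField_logFMinus hq hr.ne'
  have hFp := isBosonField_logFPlus hq hr.ne'
  have hΦ := isBosonField_logPhi hq hr.ne' hk0 hk2' l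
  have hΨ := isBosonField_logPsiStar hq hrs.ne' hk0 hk2' l
  have cΦ := sum_oscContr_logPhi hq hr.ne' hrs.ne' hk0 hk2' l
  have cΨ := sum_oscContr_logPsiStar hq hr.ne' hrs.ne' hk0 hk2' l
  have zΦ := zeroContr_logPhi hr.ne' hrs.ne' hk2' l
  have zΨ := zeroContr_logPsiStar hr.ne' hrs.ne' hk2' l
  simp only [forall_and] at cΦ cΨ zΦ zΨ
  obtain ⟨c₁, c₂, c₃, c₄, c₅, c₆, c₇, c₈, c₉, c₁₀, c₁₁, c₁₂⟩ := cΦ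
  obtain ⟨d₁, d₂, d₃, d₄, d₅, d₆, d₇, d₈, d₉, d₁₀, d₁₁, d₁₂⟩ := cΨ
  obtain ⟨y₁, y₂, y₃, y₄, y₅, y₆⟩ := zΦ
  obtain ⟨z₁, z₂, z₃, z₄, z₅, z₆⟩ := zΨ
  refine ⟨?_, ?_, exchangeRel_E hq (exchangeRel_nexp_one hq hEp hΦ c₅ c₆ y₃)
    (exchangeRel_nexp_one hq hEm hΦ c₇ c₈ y₄), exchangeRel_F hq ?_ ?_, ?_, ?_,
    exchangeRel_F hq (exchangeRel_nexp_one hq hFm hΨ d₅ d₆ z₃)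
    (exchangeRel_nexp_one hq hFp hΨ d₇ d₈ z₄), exchangeRel_E hq ?_ ?_⟩
  -- For Φ one has m = -l and ν = r. The contraction with H⁺ has β = k/2 - r, hence γ = k/2.
  · refine (exchangeRel_nexp_theta hq hr (γ := P.k / 2) (.inl rfl) hHp hΦ c₁ c₂ y₁).congr ?_ ?_ <;>
    intro u v <;> congr 1 <;> ring
  · refine (exchangeRel_nexp_theta hq hr (γ := -(P.k / 2)) (.inr rfl) hHm hΦ c₃ c₄ y₂).congr ?_ ?_ <;>
    intro u v <;> congr 1 <;> ring
  -- The summands of F have β = r and β = -r, the two alternatives for γ = 0, and so the same theta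
  -- quotient.
  · refine (exchangeRel_nexp_theta hq hr (γ := 0) (.inr (zero_add _).symm) hFm hΦ c₉ c₁₀ y₅).congr
      ?_ ?_ <;>
    intro u v <;> congr 1 <;> ring
  · refine (exchangeRel_nexp_theta hq hr (γ := 0) (.inl (zero_sub _).symm) hFp hΦ c₁₁ c₁₂ y₆).congr
      ?_ ?_ <;>
    intro u v <;> congr 1 <;> ring
  -- For Ψ* the modulus is r*, and the same β = k/2 - r equals -k/2 - r*. Hence γ changes sign,
  -- which reverses the shift by k/4.
  · refine (exchangeRel_nexp_theta hq hrs (γ := -(P.k / 2)) (.inl (by rw [hrs']; ring)) hHp hΨ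
      d₁ d₂ z₁).congr ?_ ?_ <;>
    intro u v <;> congr 1 <;> ring
  · refine (exchangeRel_nexp_theta hq hrs (γ := P.k / 2) (.inr (by rw [hrs']; ring)) hHm hΨ
      d₃ d₄ z₂).congr ?_ ?_ <;>
    intro u v <;> congr 1 <;> ring
  · refine (exchangeRel_nexp_theta hq hrs (γ := 0) (.inl (zero_sub _).symm) hEp hΨ
      d₉ d₁₀ z₅).congr ?_ ?_ <;>
    intro u v <;> congr 1 <;> ring
  · refine (exchangeRel_nexp_theta hq hrs (γ := 0) (.inr (zero_add _).symm) hEm hΨ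
      d₁₁ d₁₂ z₆).congr ?_ ?_ <;>
    intro u v <;> congr 1 <;> ring
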